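/- Let $n\ge 0$, $G=\mathrm{GL}_n(\mathbb C)$, $\mathfrak g=\mathrm{Mat}_n(\mathbb C)$, let $T\subset B\subset G$ be a maximal torus and a Borel subgroup, $s\in T$ and $q_0\in\mathbb C^*$. For a subgroup $H\subset G$ write $H(s)$ for the centralizer of $s$ in $H$. For a Borel subgroup $B'$ let $\mathfrak n_{B'}$ be the nilradical of its Lie algebra, and put $\mathfrak n=\mathfrak n_B$. Let $$\mathcal N^{(s,q_0)}=\{x\in\mathfrak g \text{ nilpotent}\mid sxs^{-1}=q_0x\},$$ $$\tilde{\mathcal N}^{(s,q_0)}=\{(x,B')\mid B'\subset G\text{ a Borel subgroup},\ s\in B',\ x\in\mathfrak n_{B'}\cap\mathcal N^{(s,q_0)}\},$$ a closed subvariety of $\mathfrak g\times\mathcal B$, where $\mathcal B$ is the variety of all Borel subgroups. Identify the Weyl group of $T$, with the simple reflections determined by $B$, with $S_n$. For $w\in S_n$ write ${}^wB=\dot wB\dot w^{-1}$ and ${}^w\mathfrak n=\dot w\mathfrak n\dot w^{-1}$, where $\dot w$ is a representative of $w$ in the normalizer of $T$. Let $S_{\mathbf v}\subset S_n$ be the subgroup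 generated by the reflections in the roots $\alpha$ of $(G,T)$ with $\alpha(s)=1$. (If $s=\mathrm{diag}(c_1,\dots,c_1,\dots,c_m,\dots,c_m)$ with $c_1,\dots,c_m$ distinct, $c_i$ repeated $v_i$ times, $T$ is the diagonal torus and $B$ the group of upper triangular matrices, then $S_{\mathbf v}$ is the Young subgroup $S_{v_1}\times\dots\times S_{v_m}$.) Let ${}^{\mathbf v}S_n$ be the set of those $w\in S_n$ that have minimal length in their coset $S_{\mathbf v}w$. Then: 1. The pairwise distinct groups ${}^wB$, $w\in{}^{\mathbf v}S_n$, are exactly the Borel subgroups $B'$ with $s\in B'$ and $B'(s)=B(s)$, and they are also exactly the Borel subgroups $B'\supset T$ with $B'(s)=B(s)$. 2. For $w\in{}^{\mathbf v}S_n$ the group $B(s)$ acts on ${}^w\mathfrak n\cap\mathcal N^{(s,q_0)}$ by conjugation, and $$G(s)\times^{B(s)}({}^w\mathfrak n\cap\mathcal N^{(s,q_0)})\to\tilde{\mathcal N}^{(s,q_0)},\qquad [h,x]\mapsto(hxh^{-1},\,h\,{}^wB\,h^{-1})$$ is a well-defined isomorphism of varieties (and a homeomorphism in the analytic topology) onto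 a connected component of $\tilde{\mathcal N}^{(s,q_0)}$. Every connected component is obtained in this way from exactly one $w\in{}^{\mathbf v}S_n$. Here connected components may be taken in the analytic or in the Zariski topology. -/

import Mathlib

noncomputable section

namespace SpringerFixed

open Matrix

/-- `n × n` complex matrices, i.e. the Lie algebra of `GL_n`. -/
abbrev Mat (n : ℕ) := Matrix (Fin n) (Fin n) ℂ

/-- The group `GL_n(ℂ)`. -/
abbrev GLn (n : ℕ) := GL (Fin n) ℂ

variable {n : ℕ}

/-! ### Borel subgroups, maximal tori, nilradicals -/

/-- The adjoint action `x ↦ h x h⁻¹` of `GL_n` on matrices. -/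
def Ad (h : GLn n) (x : Mat n) : Mat n := (h : Mat n) * x * ((h⁻¹ : GLn n) : Mat n)

/-- The conjugate subgroup `h H h⁻¹`. -/
def conjSubgroup (h : GLn n) (H : Subgroup (GLn n)) : Subgroup (GLn n) :=
  H.map (MulAut.conj h).toMonoidHom

/-- The subgroup of upper triangular invertible matrices. -/
def stdBorel (n : ℕ) : Subgroup (GLn n) where
  carrier := {g | (g : Mat n).BlockTriangular id}
  one_mem' := by
    simpa using (blockTriangular_one : (1 : Mat n).BlockTriangular id)
  mul_mem' := by
    intro a b ha hb
    simpa using BlockTriangular.mul (M := (a : Mat n)) (N := (b : Mat n)) ha hb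
  inv_mem' := by
    intro a ha
    have ha' : (a : Mat n).BlockTriangular id := ha
    have : Invertible (a : Mat n) := a.invertible
    have h := blockTriangular_inv_of_blockTriangular ha'
    simpa [Matrix.coe_units_inv] using h

/-- The subgroup of diagonal invertible matrices. -/
def stdTorus (n : ℕ) : Subgroup (GLn n) where
  carrier := {g | (g : Mat n).IsDiag}
  one_mem' := by
    simp
  mul_mem' := by
    intro a b ha hb i j hij
    have ha' : (a : Mat n).IsDiag := ha
    have hb' : (b : Mat n).IsDiag := hb
    change ((a : Mat n) * (b : Mat n)) i j = 0
    rw [← ha'.diagonal_diag, ← hb'.diagonal_diag, diagonal_mul_diagonal]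
    exact diagonal_apply_ne _ hij
  inv_mem' := by
    intro a ha i j hij
    have ha' : (a : Mat n).IsDiag := ha
    change ((a⁻¹ : GLn n) : Mat n) i j = 0
    rw [Matrix.coe_units_inv, ← ha'.diagonal_diag, inv_diagonal]
    exact diagonal_apply_ne _ hij

/-- Borel subgroups of `GL_n(ℂ)`: the conjugates of the upper triangular group. -/
def IsBorel (H : Subgroup (GLn n)) : Prop := ∃ g : GLn n, H = conjSubgroup g (stdBorel n)

/-- Maximal tori of `GL_n(ℂ)`: the conjugates of the diagonal group. -/
def IsMaximalTorus (H : Subgroup (GLn n)) : Prop := ∃ g : GLn n, H = conjSubgroup g (stdTorus n)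

/-- The nilradical `𝔫'` of the Lie algebra of a Borel subgroup `B'`: if `B' = g B₀ g⁻¹` with `B₀`
the upper triangular group, it is `g 𝔫₀ g⁻¹` with `𝔫₀` the strictly upper triangular matrices. -/
def nilradical (B' : Subgroup (GLn n)) : Set (Mat n) :=
  {x | ∃ g : GLn n, B' = conjSubgroup g (stdBorel n) ∧ ∀ i j, j ≤ i → Ad g⁻¹ x i j = 0}

/-! ### The flag variety and the fixed point varieties -/

/-- The flag variety `ℬ`: the set of all Borel subgroups. -/
def FlagVariety (n : ℕ) := {B' : Subgroup (GLn n) // IsBorel B'}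

/-- The orbit map `g ↦ g B₀ g⁻¹`, with `B₀` the upper triangular group. -/
def FlagVariety.orbit (g : GLn n) : FlagVariety n := ⟨conjSubgroup g (stdBorel n), g, rfl⟩

/-- The (complex analytic) topology of `ℬ = GL_n / B₀`: the quotient topology. -/
instance : TopologicalSpace (FlagVariety n) :=
  TopologicalSpace.coinduced FlagVariety.orbit inferInstance

/-- `𝒩^{(s,q₀)}`: the nilpotent matrices `x` with `s x s⁻¹ = q₀ x`. -/
def nilcone (s : GLn n) (q₀ : ℂˣ) : Set (Mat n) :=
  {x | IsNilpotent x ∧ Ad s x = (q₀ : ℂ) • x}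

/-- `Ñ^{(s,q₀)}`: the pairs `(x, B')` of some `x ∈ 𝒩^{(s,q₀)}` and a Borel subgroup `B'` containing
`s` with `x ∈ 𝔫'`. Its analytic topology is the subspace topology from `Mat n × ℬ`. -/
def NTilde (s : GLn n) (q₀ : ℂˣ) : Set (Mat n × FlagVariety n) :=
  {p | p.1 ∈ nilcone s q₀ ∧ s ∈ p.2.1 ∧ p.1 ∈ nilradical p.2.1}

/-- The centralizer `G(s)`. -/
def centr (s : GLn n) : Subgroup (GLn n) := Subgroup.centralizer {s}

/-! ### Associated bundles -/

/-- The equivalence relation `(h, x) ∼ (h b⁻¹, b x b⁻¹)`, `b ∈ H`, on `K × V`. -/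
def assocSetoid (K H : Subgroup (GLn n)) (V : Set (Mat n)) : Setoid (K × V) where
  r a a' := ∃ b ∈ H, (a'.1 : GLn n) = a.1 * b⁻¹ ∧ (a'.2 : Mat n) = Ad b a.2
  iseqv := by
    refine ⟨fun a => ⟨1, H.one_mem, by simp, by simp [Ad]⟩, ?_, ?_⟩
    · rintro a a' ⟨b, hb, h1, h2⟩
      refine ⟨b⁻¹, H.inv_mem hb, by simp [h1], ?_⟩
      rw [h2]
      simp only [Ad, inv_inv]
      calc (a.2 : Mat n) = ((b⁻¹ * b : GLn n) : Mat n) * a.2 * ((b⁻¹ * b : GLn n) : Mat n) := by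
            simp
        _ = _ := by simp only [Units.val_mul, mul_assoc]
    · rintro a a' a'' ⟨b, hb, h1, h2⟩ ⟨c, hc, h3, h4⟩
      refine ⟨c * b, H.mul_mem hc hb, by simp [h1, h3, mul_assoc], ?_⟩
      rw [h4, h2]
      simp only [Ad, _root_.mul_inv_rev, Units.val_mul, mul_assoc]

/-- The associated bundle `K ×^H V` for `H` acting on `V` by conjugation, with its quotient
topology. -/
abbrev AssocBundle (K H : Subgroup (GLn n)) (V : Set (Mat n)) := Quotient (assocSetoid K H V)

/-! ### The structure of an algebraic variety on a quotient -/

section Variety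

variable {Z Y κ : Type*}

/-- Let `Z` be a locally closed subset of the affine space `ℂ^κ` (included by `c`), and `π` a
quotient map from `Z` onto `Y`. A function `f` on `Y` is regular at `y` if `f ∘ π` is, at each point
above `y`, a quotient of polynomials on a Zariski neighbourhood. -/
def RegularAt (c : Z → κ → ℂ) (π : Z → Y) (f : Y → ℂ) (y : Y) : Prop :=
  ∀ z, π z = y → ∃ p r : MvPolynomial κ ℂ, MvPolynomial.eval (c z) r ≠ 0 ∧
    ∀ z', MvPolynomial.eval (c z') r ≠ 0 →
      f (π z') = MvPolynomial.eval (c z') p / MvPolynomial.eval (c z') r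

/-- The Zariski topology of `Y`: the quotient of the Zariski topology of `Z ⊆ ℂ^κ`. -/
@[reducible] def zariskiTopology (c : Z → κ → ℂ) (π : Z → Y) : TopologicalSpace Y :=
  TopologicalSpace.coinduced π (TopologicalSpace.generateFrom
    {U | ∃ p : MvPolynomial κ ℂ, U = {z | MvPolynomial.eval (c z) p ≠ 0}})

end Variety

/-- The coordinates of a pair of matrices. -/
def pairCoord (a x : Mat n) : (Fin n × Fin n) ⊕ (Fin n × Fin n) → ℂ :=
  Sum.elim (fun e => a e.1 e.2) (fun e => x e.1 e.2)

/-- The preimage of `Ñ^{(s,q₀)} ⊆ Mat n × GL_n/B₀` in `GL_n × Mat n`. -/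
def NTildeCover (s : GLn n) (q₀ : ℂˣ) :=
  {a : GLn n × Mat n // (a.2, FlagVariety.orbit a.1) ∈ NTilde s q₀}

def NTildeCover.coord (s : GLn n) (q₀ : ℂˣ) (a : NTildeCover s q₀) :
    (Fin n × Fin n) ⊕ (Fin n × Fin n) → ℂ := pairCoord (a.1.1 : Mat n) a.1.2

def NTildeCover.proj (s : GLn n) (q₀ : ℂˣ) (a : NTildeCover s q₀) : NTilde s q₀ := ⟨_, a.2⟩

/-- Regular functions of the reduced variety `Ñ^{(s,q₀)}`. -/
def NTilde.RegularAt {s : GLn n} {q₀ : ℂˣ} (f : NTilde s q₀ → ℂ) (y : NTilde s q₀) : Prop :=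
  SpringerFixed.RegularAt (NTildeCover.coord s q₀) (NTildeCover.proj s q₀) f y

/-- The Zariski topology of `Ñ^{(s,q₀)}`. -/
@[reducible] def NTilde.zariski (s : GLn n) (q₀ : ℂˣ) : TopologicalSpace (NTilde s q₀) :=
  zariskiTopology (NTildeCover.coord s q₀) (NTildeCover.proj s q₀)

/-- Regular functions of the variety `K ×^H V`. -/
def AssocBundle.RegularAt {K H : Subgroup (GLn n)} {V : Set (Mat n)}
    (f : AssocBundle K H V → ℂ) (y : AssocBundle K H V) : Prop :=
  SpringerFixed.RegularAt (fun a : K × V => pairCoord ((a.1 : GLn n) : Mat n) (a.2 : Mat n))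
    (Quotient.mk (assocSetoid K H V)) f y

/-! ### The Weyl group -/

/-- A basis of `ℂ^n` (the columns of `g`) adapted to a Borel subgroup `B` and a maximal torus
`T ⊆ B`: `T` is diagonal and `B` upper triangular in this basis. It is unique up to rescaling the
basis vectors and identifies the Weyl group of `(T, B)`, with its simple reflections, with `S_n`. -/
def IsAdapted (g : GLn n) (T B : Subgroup (GLn n)) : Prop :=
  T = conjSubgroup g (stdTorus n) ∧ B = conjSubgroup g (stdBorel n)

/-- The permutation matrix sending `e_j` to `e_{w j}`. -/
def permGL (w : Equiv.Perm (Fin n)) : GLn n where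
  val := Matrix.of fun i j => if i = w j then 1 else 0
  inv := Matrix.of fun i j => if i = w⁻¹ j then 1 else 0
  val_inv := by
    ext i j
    simp [Matrix.mul_apply, Matrix.one_apply]
  inv_val := by
    ext i j
    simp [Matrix.mul_apply, Matrix.one_apply]

/-- The representative in the normalizer of `T` of the Weyl group element `w`. -/
def weylLift (g : GLn n) (w : Equiv.Perm (Fin n)) : GLn n := g * permGL w * g⁻¹

/-- `S_𝐯`: the Weyl group of `Φ_𝐯 = {α ∈ Φ | α(s) = 1}`, generated by the reflections in the
`α ∈ Φ_𝐯`. Here the root `α = ε_i - ε_j` has `α(s) = 1` if and only if the `i`-th and `j`-th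
eigenvalue of `s` in the adapted basis agree. -/
def youngSubgroup (g s : GLn n) : Subgroup (Equiv.Perm (Fin n)) :=
  Subgroup.closure {u | ∃ i j : Fin n, i ≠ j ∧
    ((g⁻¹ * s * g : GLn n) : Mat n) i i = ((g⁻¹ * s * g : GLn n) : Mat n) j j ∧
    u = Equiv.swap i j}

/-- The length of a permutation: its number of inversions. -/
def length (w : Equiv.Perm (Fin n)) : ℕ :=
  (Finset.univ.filter fun e : Fin n × Fin n => e.1 < e.2 ∧ w e.2 < w e.1).card

/-- `^𝐯S_n`: the elements `w` of minimal length in their coset `S_𝐯 w`. -/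
def minReps (g s : GLn n) : Set (Equiv.Perm (Fin n)) :=
  {w | ∀ u ∈ youngSubgroup g s, length w ≤ length (u * w)}

/-- `^wB`. -/
def twistBorel (g : GLn n) (w : Equiv.Perm (Fin n)) (B : Subgroup (GLn n)) : Subgroup (GLn n) :=
  conjSubgroup (weylLift g w) B

/-- `^w𝔫 ∩ 𝒩^{(s,q₀)}`. -/
def fibre (g : GLn n) (w : Equiv.Perm (Fin n)) (B : Subgroup (GLn n)) (s : GLn n) (q₀ : ℂˣ) :
    Set (Mat n) :=
  (Ad (weylLift g w) '' nilradical B) ∩ nilcone s q₀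

end SpringerFixed

end

/-!
Fix a basis (the columns of `g`) in which `T` is diagonal and `B` upper triangular, and let
`d = eigs g s` be the eigenvalues of `s` in it. A Borel subgroup is the stabilizer of a flag `a`, and
it contains `s` if and only if `s` preserves the flag; then `s` acts on the successive quotients of
the flag by a permutation `d ∘ w` of its eigenvalues, and `w` is unique if it is required to have
minimal length in its coset. Indeed minimality means that `w⁻¹` is increasing on each set of indices
with equal eigenvalue (`mem_minReps_iff`), which is also what `^wB(s) = B(s)` says
(`twist_inf_centr_eq_iff`).

The key point is that, for given `w`, the flags of this type are a single orbit of the centralizer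
`G(s)`, with a section that is linear in `a` (`exists_centr_eq_secMat`): project `a * (permGL w)⁻¹`
to the centralizer algebra of `s`. Column by column this applies a spectral projector of `s` to a
vector of the flag; the projectors are polynomials in `s`, so they preserve the flag and act on each
subquotient by `0` or `1`. The case of a regular `s` gives the description of the Borel subgroups
containing `T` and the self-normalization of a Borel subgroup.

The map `[h, x] ↦ (h x h⁻¹, h ^wB h⁻¹)` is therefore a bijection onto the part of `Ñ` lying over these
flags, and the section makes its inverse continuous (`isOpenMap_bundleMap`) and rational
(`regularAt_of_comp_bundleMap`). These parts are open, even Zariski open (`exists_poly_stratum`), since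
the eigenvalues on the subquotients depend algebraically on the flag and take finitely many values.
They are connected, since `G(s)` is connected (`isPreconnected_univ_centr`) and `^w𝔫 ∩ 𝒩` is
star-shaped around `0`. So they are the connected components in both topologies.
-/

noncomputable section

namespace SpringerFixed

open Matrix

variable {n : ℕ}

/-! ### Minimal length representatives of the cosets of the Young subgroup -/

/-- The inversions of `w * swap p q` inject into those of `w`, by moving each pair along `swap p q`
whenever this keeps it increasing; the inversion `(p, q)` of `w` is not hit. -/
lemma length_mul_swap_lt (w : Equiv.Perm (Fin n)) {p q : Fin n} (hpq : p < q) (hw : w q < w p) :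
    length (w * Equiv.swap p q) < length w := by
  set τ := Equiv.swap p q with hτ
  let f : Fin n × Fin n → Fin n × Fin n := fun e => if τ e.1 < τ e.2 then (τ e.1, τ e.2) else e
  have hττ : ∀ a, τ (τ a) = a := fun a => Equiv.swap_apply_self p q a
  unfold length
  have hinj : Set.InjOn f {e : Fin n × Fin n | e.1 < e.2} := by
    rintro ⟨a, b⟩ hab ⟨a', b'⟩ hab' h
    simp only [Set.mem_ofPred_eq] at hab hab'
    simp only [f] at h
    split_ifs at h with h1 h2 h2
    · simpa using h
    · simp only [Prod.mk.injEq] at h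
      rw [← h.1, ← h.2, hττ, hττ] at h2
      exact absurd hab h2
    · simp only [Prod.mk.injEq] at h
      rw [h.1, h.2, hττ, hττ] at h1
      exact absurd hab' h1
    · exact h
  rw [← Finset.card_image_of_injOn (hinj.mono fun e he =>
    (Finset.mem_filter.1 (Finset.mem_coe.1 he)).2.1)]
  apply Finset.card_lt_card
  rw [Finset.ssubset_iff_of_subset]
  · refine ⟨(p, q), by simp [hpq, hw], ?_⟩
    simp only [Finset.mem_image, Finset.mem_filter, Finset.mem_univ, true_and, not_exists, not_and]
    rintro ⟨a, b⟩ ⟨hab, h2⟩ h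
    simp only [f, Equiv.Perm.mul_apply] at h h2 hab
    split_ifs at h with h1
    · simp only [Prod.mk.injEq] at h
      have ha : a = q := by rw [← hττ a, h.1]; simp [hτ]
      have hb : b = p := by rw [← hττ b, h.2]; simp [hτ]
      subst ha hb
      exact absurd hab hpq.asymm
    · simp only [Prod.mk.injEq] at h
      rw [h.1, h.2, Equiv.swap_apply_left, Equiv.swap_apply_right] at h2
      exact absurd hw h2.asymm
  · intro e he
    simp only [Finset.mem_image, Finset.mem_filter, Finset.mem_univ, true_and] at he
    obtain ⟨⟨a, b⟩, ⟨hab, h2⟩, rfl⟩ := he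
    simp only [Equiv.Perm.mul_apply] at h2 hab
    simp only [Finset.mem_filter, Finset.mem_univ, true_and, f]
    split_ifs with h1
    · exact ⟨h1, h2⟩
    · refine ⟨hab, ?_⟩
      change w (τ b) < w (τ a) at h2
      -- here the pair `a < b` is `(p, q)`, `(p, b)` with `b < q`, or `(a, q)` with `p < a`
      simp only [hτ, Equiv.swap_apply_def] at h1 h2
      split_ifs at h1 h2 <;> subst_vars <;> order

/-- The classes of indices with the same value of `d` are listed by `w⁻¹` in increasing order. -/
def SortedOn (d : Fin n → ℂ) (w : Equiv.Perm (Fin n)) : Prop :=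
  ∀ i j, i < j → d i = d j → w⁻¹ i < w⁻¹ j

/-- Otherwise `i < σ i < σ² i < ⋯` would be an infinite increasing sequence. -/
lemma not_lt_apply_of_strictMonoOn_classes {ι : Type*} [Preorder ι] [Finite ι] {γ : Type*}
    (c : ι → γ) (σ : Equiv.Perm ι) (hc : ∀ i, c (σ i) = c i)
    (h : ∀ i j, i < j → c i = c j → σ i < σ j) (i : ι) : ¬ i < σ i := by
  intro hi
  have hcl : ∀ k : ℕ, c ((σ ^ k) i) = c i := by
    intro k
    induction k with
    | zero => rfl
    | succ k ih => rw [pow_succ', Equiv.Perm.mul_apply, hc, ih]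
  have hst : ∀ k : ℕ, (σ ^ k) i < (σ ^ (k + 1)) i := by
    intro k
    induction k with
    | zero => simpa using hi
    | succ k ih =>
      rw [pow_succ' σ k, pow_succ' σ (k + 1), Equiv.Perm.mul_apply, Equiv.Perm.mul_apply]
      exact h _ _ ih (by rw [hcl, hcl])
  exact not_injective_infinite_finite _
    (strictMono_nat_of_lt_succ (f := fun k => (σ ^ k) i) hst).injective

lemma perm_eq_one_of_strictMonoOn_classes {ι : Type*} [LinearOrder ι] [Finite ι] {γ : Type*}
    (c : ι → γ) (σ : Equiv.Perm ι) (hc : ∀ i, c (σ i) = c i)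
    (h : ∀ i j, i < j → c i = c j → σ i < σ j) : σ = 1 := by
  ext i
  exact le_antisymm (not_lt.1 (not_lt_apply_of_strictMonoOn_classes c σ hc h i))
    (not_lt.1 (not_lt_apply_of_strictMonoOn_classes (ι := ιᵒᵈ) c σ hc
      (fun i j hij hd => h j i hij hd.symm) i))

lemma SortedOn.eq_of_comp_eq {d : Fin n → ℂ} {w w' : Equiv.Perm (Fin n)} (hw : SortedOn d w)
    (hw' : SortedOn d w') (h : ∀ i, d (w i) = d (w' i)) : w = w' := by
  have : w'⁻¹ * w = 1 := by
    apply perm_eq_one_of_strictMonoOn_classes (fun i => d (w i))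
    · intro i
      rw [h]
      simp
    · intro i j hij hd
      simp only [Equiv.Perm.mul_apply]
      apply hw' _ _ _ hd
      -- `w` is increasing on the class, since `w⁻¹` is
      by_contra hlt
      rcases (not_lt.1 hlt).lt_or_eq with h1 | h1
      · have := hw _ _ h1 hd.symm
        simp only [Equiv.Perm.inv_def, Equiv.symm_apply_apply] at this
        exact absurd hij this.asymm
      · exact absurd (w.injective h1) hij.ne'
  rw [inv_mul_eq_one] at this
  exact this.symm

/-- The eigenvalues of `s` in the basis given by the columns of `g`. -/
def eigs (g s : GLn n) (i : Fin n) : ℂ := ((g⁻¹ * s * g : GLn n) : Mat n) i i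

lemma eigs_apply_of_mem_youngSubgroup {g s : GLn n} {u : Equiv.Perm (Fin n)}
    (hu : u ∈ youngSubgroup g s) (i : Fin n) : eigs g s (u i) = eigs g s i := by
  induction hu using Subgroup.closure_induction generalizing i with
  | mem u hu =>
    obtain ⟨a, b, -, hab, rfl⟩ := hu
    change eigs g s a = eigs g s b at hab
    rw [Equiv.swap_apply_def]
    split_ifs with h1 h2
    · rw [h1, hab]
    · rw [h2, hab]
    · rfl
  | one => rfl
  | mul a b _ _ ha hb => rw [Equiv.Perm.mul_apply, ha, hb]
  | inv a _ ha => rw [← ha (a⁻¹ i), Equiv.Perm.inv_def, Equiv.apply_symm_apply]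

lemma sortedOn_of_mem_minReps {g s : GLn n} {w : Equiv.Perm (Fin n)} (hw : w ∈ minReps g s) :
    SortedOn (eigs g s) w := by
  intro i j hij hd
  by_contra hlt
  have hlt' : w⁻¹ j < w⁻¹ i :=
    lt_of_le_of_ne (not_lt.1 hlt) fun h => hij.ne' (w⁻¹.injective h)
  have h1 := length_mul_swap_lt w hlt' (by simpa using hij)
  have h2 : w * Equiv.swap (w⁻¹ j) (w⁻¹ i) = Equiv.swap i j * w := by
    rw [Equiv.mul_swap_eq_swap_mul, Equiv.Perm.inv_def, Equiv.apply_symm_apply,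
      Equiv.apply_symm_apply, Equiv.swap_comm]
  rw [h2] at h1
  exact absurd (hw _ (Subgroup.subset_closure ⟨i, j, hij.ne, hd, rfl⟩)) (not_le.2 h1)

lemma exists_minReps_comp_eq (g s : GLn n) (w : Equiv.Perm (Fin n)) :
    ∃ w' ∈ minReps g s, ∀ i, eigs g s (w' i) = eigs g s (w i) := by
  obtain ⟨u, hu, hmin⟩ := Set.exists_min_image (youngSubgroup g s : Set (Equiv.Perm (Fin n)))
    (fun u => length (u * w)) (Set.toFinite _) ⟨1, one_mem _⟩
  refine ⟨u * w, fun v hv => ?_, fun i => eigs_apply_of_mem_youngSubgroup hu _⟩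
  rw [← mul_assoc]
  exact hmin _ (mul_mem hv hu)

lemma mem_minReps_iff {g s : GLn n} {w : Equiv.Perm (Fin n)} :
    w ∈ minReps g s ↔ SortedOn (eigs g s) w := by
  refine ⟨sortedOn_of_mem_minReps, fun hw => ?_⟩
  obtain ⟨w', hw', h⟩ := exists_minReps_comp_eq g s w
  rwa [← (sortedOn_of_mem_minReps hw').eq_of_comp_eq hw h]

/-! ### Conjugation, permutation matrices and upper triangular matrices -/

lemma Ad_one (x : Mat n) : Ad 1 x = x := by simp [Ad]

lemma Ad_mul (a b : GLn n) (x : Mat n) : Ad (a * b) x = Ad a (Ad b x) := by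
  simp only [Ad, _root_.mul_inv_rev, Units.val_mul, mul_assoc]

lemma Ad_inv_Ad (a : GLn n) (x : Mat n) : Ad a⁻¹ (Ad a x) = x := by
  rw [← Ad_mul, inv_mul_cancel, Ad_one]

lemma Ad_Ad_inv (a : GLn n) (x : Mat n) : Ad a (Ad a⁻¹ x) = x := by
  rw [← Ad_mul, mul_inv_cancel, Ad_one]

lemma Ad_smul (a : GLn n) (c : ℂ) (x : Mat n) : Ad a (c • x) = c • Ad a x := by
  simp [Ad]

lemma det_val_ne_zero (h : GLn n) : (h : Mat n).det ≠ 0 :=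
  isUnit_iff_ne_zero.1 ((isUnit_iff_isUnit_det _).1 h.isUnit)

lemma mem_conjSubgroup {h x : GLn n} {H : Subgroup (GLn n)} :
    x ∈ conjSubgroup h H ↔ h⁻¹ * x * h ∈ H := by
  unfold conjSubgroup
  rw [Subgroup.mem_map_equiv]
  simp

lemma conjSubgroup_conjSubgroup (a b : GLn n) (H : Subgroup (GLn n)) :
    conjSubgroup a (conjSubgroup b H) = conjSubgroup (a * b) H := by
  ext x
  simp only [mem_conjSubgroup, _root_.mul_inv_rev, mul_assoc]

lemma conjSubgroup_eq_self {h : GLn n} {H : Subgroup (GLn n)} (hh : h ∈ H) :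
    conjSubgroup h H = H := by
  ext x
  rw [mem_conjSubgroup, H.mul_mem_cancel_right hh, H.mul_mem_cancel_left (H.inv_mem hh)]

lemma mem_stdBorel {b : GLn n} : b ∈ stdBorel n ↔ ∀ i j, j < i → (b : Mat n) i j = 0 :=
  ⟨fun h _ _ hij => h hij, fun h _ _ hij => h _ _ hij⟩

lemma mem_centr {s h : GLn n} : h ∈ centr s ↔ h * s = s * h := by
  rw [centr, Subgroup.mem_centralizer_singleton_iff]

lemma mul_permGL_apply (A : Mat n) (w : Equiv.Perm (Fin n)) (i j : Fin n) :
    (A * (permGL w : GLn n)) i j = A i (w j) := by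
  simp [permGL, mul_apply]

lemma mul_permGL_inv_apply (A : Mat n) (w : Equiv.Perm (Fin n)) (i j : Fin n) :
    (A * ((permGL w)⁻¹ : GLn n)) i j = A i (w⁻¹ j) := by
  change (A * (Matrix.of fun i j => if i = w⁻¹ j then 1 else 0 : Mat n)) i j = _
  simp [mul_apply]

lemma permGL_inv_mul_apply (A : Mat n) (w : Equiv.Perm (Fin n)) (i j : Fin n) :
    (((permGL w)⁻¹ : GLn n) * A) i j = A (w i) j := by
  change ((Matrix.of fun i j => if i = w⁻¹ j then 1 else 0 : Mat n) * A) i j = _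
  simp [mul_apply, Equiv.eq_symm_apply]

lemma mem_conjSubgroup_permGL {x : GLn n} {w : Equiv.Perm (Fin n)} :
    x ∈ conjSubgroup (permGL w) (stdBorel n) ↔
      ∀ i j, w⁻¹ j < w⁻¹ i → (x : Mat n) i j = 0 := by
  rw [mem_conjSubgroup, mem_stdBorel]
  simp only [Units.val_mul, mul_permGL_apply, permGL_inv_mul_apply]
  constructor
  · intro h i j hij
    simpa using h _ _ hij
  · intro h i j hij
    exact h _ _ (by simpa using hij)

lemma BlockTriangular.mul_apply_self {A C : Mat n} (hA : A.BlockTriangular id)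
    (hC : C.BlockTriangular id) (i : Fin n) : (A * C) i i = A i i * C i i := by
  rw [mul_apply]
  apply Finset.sum_eq_single_of_mem _ (Finset.mem_univ _)
  intro k _ hk
  rcases lt_or_gt_of_ne hk with h | h
  · rw [hA h, zero_mul]
  · rw [hC h, mul_zero]

/-- Conjugating by an element of the upper triangular group does not change the diagonal of an
upper triangular matrix. -/
lemma stdBorel_conj_apply_self {b : GLn n} (hb : b ∈ stdBorel n) {u : Mat n}
    (hu : u.BlockTriangular id) (i : Fin n) :
    (((b⁻¹ : GLn n) : Mat n) * u * (b : Mat n)) i i = u i i := by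
  have hb' := (stdBorel n).inv_mem hb
  have h := BlockTriangular.mul_apply_self (A := (b : Mat n)) (C := (b⁻¹ : GLn n)) hb hb' i
  rw [← Units.val_mul, mul_inv_cancel, Units.val_one, one_apply_eq] at h
  rw [BlockTriangular.mul_apply_self (BlockTriangular.mul hb' hu) hb,
    BlockTriangular.mul_apply_self hb' hu]
  linear_combination (- u i i) * h

lemma BlockTriangular.aeval {u : Mat n} (hu : u.BlockTriangular id) (p : Polynomial ℂ) :
    (Polynomial.aeval u p).BlockTriangular id ∧
      ∀ i, (Polynomial.aeval u p) i i = p.eval (u i i) := by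
  induction p using Polynomial.induction_on' with
  | add p q hp hq =>
    simp only [map_add, Polynomial.eval_add]
    exact ⟨hp.1.add hq.1, fun i => by rw [Matrix.add_apply, hp.2, hq.2]⟩
  | monomial k c =>
    rw [Polynomial.aeval_monomial, ← Algebra.smul_def]
    have hpow : ∀ k : ℕ, (u ^ k).BlockTriangular id ∧ ∀ i, (u ^ k) i i = u i i ^ k := by
      intro k
      induction k with
      | zero => exact ⟨by simpa using blockTriangular_one, fun i => by simp⟩
      | succ k ih =>
        rw [pow_succ]
        exact ⟨ih.1.mul hu, fun i => by
          rw [BlockTriangular.mul_apply_self ih.1 hu, ih.2, pow_succ]⟩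
    refine ⟨fun i j hij => ?_, fun i => ?_⟩
    · rw [Matrix.smul_apply, (hpow k).1 hij, smul_zero]
    · rw [Matrix.smul_apply, (hpow k).2, Polynomial.eval_monomial, smul_eq_mul]

lemma aeval_conj_diagonal (a : GLn n) (d : Fin n → ℂ) (p : Polynomial ℂ) :
    Polynomial.aeval (((a⁻¹ : GLn n) : Mat n) * diagonal d * (a : Mat n)) p =
      ((a⁻¹ : GLn n) : Mat n) * diagonal (fun k => p.eval (d k)) * (a : Mat n) := by
  induction p using Polynomial.induction_on' with
  | add p q hp hq =>
    simp only [map_add, Polynomial.eval_add, hp, hq, ← diagonal_add, mul_add, add_mul]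
  | monomial k c =>
    rw [Polynomial.aeval_monomial, ← Algebra.smul_def, Units.conj_pow', diagonal_pow]
    have : (diagonal fun i => (Polynomial.monomial k c).eval (d i)) = c • diagonal (d ^ k) := by
      rw [← diagonal_smul]
      congr 1
      ext i
      simp
    rw [this, mul_smul_comm, smul_mul_assoc]

lemma exists_poly_indicator (d : Fin n → ℂ) (c : ℂ) :
    ∃ p : Polynomial ℂ, ∀ k, p.eval (d k) = if d k = c then 1 else 0 := by
  classical
  refine ⟨Lagrange.interpolate (Finset.univ.image d) id (fun x => if x = c then 1 else 0),
    fun k => ?_⟩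
  exact Lagrange.eval_interpolate_at_node (v := id) (fun x => if x = c then (1 : ℂ) else 0)
    (Function.injective_id.injOn) (Finset.mem_image_of_mem d (Finset.mem_univ k))

/-! ### Flags stable under a diagonal matrix -/

/-- The projection of `Mat n` onto the centralizer of `diagonal d` along the span of the elementary
matrices `E_{kl}` with `d k ≠ d l`. -/
def mask (d : Fin n → ℂ) (A : Mat n) : Mat n := Matrix.of fun k l => if d k = d l then A k l else 0

/-- If the flag of `a` is stable under `diagonal d`, with eigenvalue `d (w i)` on the `i`-th
subquotient, then the projection of `a * (permGL w)⁻¹` to the centralizer of `diagonal d`, times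
`permGL w`, spans the same flag. Indeed its `i`-th column is the image of the `i`-th column of `a`
under the spectral projector for the eigenvalue `d (w i)`; the projector is a polynomial in
`diagonal d`, so it preserves the flag, and it acts on the `i`-th subquotient as the identity. -/
lemma exists_mask_mul_permGL (d : Fin n → ℂ) (a : GLn n) (w : Equiv.Perm (Fin n))
    (hu : (((a⁻¹ : GLn n) : Mat n) * diagonal d * (a : Mat n)).BlockTriangular id)
    (hd : ∀ i, (((a⁻¹ : GLn n) : Mat n) * diagonal d * (a : Mat n)) i i = d (w i)) :
    ∃ b ∈ stdBorel n,
      mask d ((a : Mat n) * ((permGL w)⁻¹ : GLn n)) * (permGL w : GLn n) =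
        (a : Mat n) * (b : Mat n) := by
  choose p hp using exists_poly_indicator d
  set u := ((a⁻¹ : GLn n) : Mat n) * diagonal d * (a : Mat n) with hu_def
  let b : Mat n := Matrix.of fun k i => (Polynomial.aeval u (p (d (w i)))) k i
  have hb : b.BlockTriangular id := fun i j hij => (BlockTriangular.aeval hu _).1 hij
  have hb1 : ∀ i, b i i = 1 := fun i => by
    change (Polynomial.aeval u (p (d (w i)))) i i = 1
    rw [(BlockTriangular.aeval hu _).2, hd, hp, if_pos rfl]
  have hdet : IsUnit b.det := by
    rw [det_of_isUpperTriangular hb]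
    simp [hb1]
  refine ⟨GeneralLinearGroup.mk'' b hdet, hb, ?_⟩
  change _ = (a : Mat n) * b
  ext k i
  have h1 : ((a : Mat n) * b) k i = ((a : Mat n) * Polynomial.aeval u (p (d (w i)))) k i := by
    simp only [mul_apply, b, of_apply]
  rw [h1, hu_def, aeval_conj_diagonal, ← mul_assoc, ← mul_assoc, Units.mul_inv, one_mul,
    diagonal_mul, hp, mul_permGL_apply]
  simp only [mask, of_apply, mul_permGL_inv_apply]
  simp

/-- The eigenvalues on the subquotients of a stable flag are a permutation of the diagonal. -/
lemma exists_perm_diag_eq (d : Fin n → ℂ) (a : GLn n)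
    (hu : (((a⁻¹ : GLn n) : Mat n) * diagonal d * (a : Mat n)).BlockTriangular id) :
    ∃ w : Equiv.Perm (Fin n),
      ∀ i, (((a⁻¹ : GLn n) : Mat n) * diagonal d * (a : Mat n)) i i = d (w i) := by
  classical
  set u := ((a⁻¹ : GLn n) : Mat n) * diagonal d * (a : Mat n) with hu_def
  have h1 : ∏ i, (Polynomial.X - Polynomial.C (u i i)) =
      ∏ i, (Polynomial.X - Polynomial.C (d i)) := by
    rw [← charpoly_of_isUpperTriangular u hu, ← charpoly_diagonal, hu_def,
      ← charpoly_units_conj' a (diagonal d)]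
    simp
  have h2 : Finset.univ.val.map (fun i => u i i) = Finset.univ.val.map d := by
    have h := congrArg Polynomial.roots h1
    rw [Finset.prod, Finset.prod] at h
    have e : ∀ f : Fin n → ℂ, (Finset.univ.val.map fun i => Polynomial.X - Polynomial.C (f i)) =
        (Finset.univ.val.map f).map fun c => Polynomial.X - Polynomial.C c := by
      intro f
      rw [Multiset.map_map]
      rfl
    rwa [e, e, Polynomial.roots_multiset_prod_X_sub_C, Polynomial.roots_multiset_prod_X_sub_C] at h
  have h3 : ∀ c, Nonempty ({i // u i i = c} ≃ {i // d i = c}) := by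
    intro c
    have h := congrArg (Multiset.count c) h2
    simp only [Multiset.count_map] at h
    apply Fintype.card_eq.1
    rw [Fintype.card_subtype, Fintype.card_subtype]
    simp only [eq_comm (a := c)] at h
    exact h
  exact ⟨Equiv.ofFiberEquiv fun c => (h3 c).some, fun i =>
    (Equiv.ofFiberEquiv_map (fun c => (h3 c).some) i).symm⟩

lemma eq_mul_of_mask {d : Fin n → ℂ} {a : GLn n} {w : Equiv.Perm (Fin n)} {b : GLn n}
    (h : mask d ((a : Mat n) * ((permGL w)⁻¹ : GLn n)) * (permGL w : GLn n) =
        (a : Mat n) * (b : Mat n)) :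
    mask d ((a : Mat n) * ((permGL w)⁻¹ : GLn n)) = ((a * b * (permGL w)⁻¹ : GLn n) : Mat n) := by
  rw [Units.val_mul, Units.val_mul, ← h, Units.mul_inv_cancel_right]

/-- Over the diagonal torus every stable flag is a coordinate flag. -/
lemma exists_perm_of_stdTorus_le {a : GLn n} (h : stdTorus n ≤ conjSubgroup a (stdBorel n)) :
    ∃ w : Equiv.Perm (Fin n), ∃ b ∈ stdBorel n, ∃ t ∈ stdTorus n, t * permGL w = a * b := by
  let d : Fin n → ℂ := fun i => (i : ℕ) + 1
  have hd0 : ∀ i, d i ≠ 0 := fun i => Nat.cast_add_one_ne_zero _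
  have hinj : Function.Injective d := fun i j hij => by
    simpa [d, Fin.ext_iff] using hij
  have hdet : IsUnit (diagonal d).det := by
    rw [det_diagonal, isUnit_iff_ne_zero]
    exact Finset.prod_ne_zero_iff.2 fun i _ => hd0 i
  have hmem : GeneralLinearGroup.mk'' (diagonal d) hdet ∈ stdTorus n := isDiag_diagonal d
  have hu := mem_conjSubgroup.1 (h hmem)
  change (((a⁻¹ : GLn n) : Mat n) * diagonal d * (a : Mat n)).BlockTriangular id at hu
  obtain ⟨w, hw⟩ := exists_perm_diag_eq d a hu
  obtain ⟨b, hb, hab⟩ := exists_mask_mul_permGL d a w hu hw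
  refine ⟨w, b, hb, a * b * (permGL w)⁻¹, ?_, by group⟩
  intro i j hij
  rw [← eq_mul_of_mask hab]
  exact if_neg (hinj.ne hij)

/-- The group element `1 + E_{ij}`, for `i ≠ j`. -/
def rootElt (i j : Fin n) (h : i ≠ j) : GLn n :=
  GeneralLinearGroup.mk'' (transvection i j 1) (by rw [det_transvection_of_ne i j h]; simp)

lemma rootElt_apply_self (i j : Fin n) (h : i ≠ j) : (rootElt i j h : Mat n) i j ≠ 0 := by
  change transvection i j (1 : ℂ) i j ≠ 0
  simp [transvection, h]

lemma rootElt_apply_of_ne (i j : Fin n) (h : i ≠ j) {k l : Fin n} (hkl : k ≠ l)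
    (h' : ¬ (k = i ∧ l = j)) : (rootElt i j h : Mat n) k l = 0 := by
  change transvection i j (1 : ℂ) k l = 0
  rw [transvection, Matrix.add_apply, one_apply_ne hkl, zero_add, single_apply, if_neg]
  rintro ⟨rfl, rfl⟩
  exact h' ⟨rfl, rfl⟩

lemma rootElt_mem_permGL {i j : Fin n} (h : i ≠ j) {w : Equiv.Perm (Fin n)} :
    rootElt i j h ∈ conjSubgroup (permGL w) (stdBorel n) ↔ w⁻¹ i < w⁻¹ j := by
  rw [mem_conjSubgroup_permGL]
  constructor
  · intro hh
    by_contra hlt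
    have : w⁻¹ j < w⁻¹ i := lt_of_le_of_ne (not_lt.1 hlt) fun e => h (w⁻¹.injective e).symm
    exact rootElt_apply_self i j h (hh i j this)
  · intro hlt k l hkl
    apply rootElt_apply_of_ne i j h
    · rintro rfl
      exact lt_irrefl _ hkl
    · rintro ⟨rfl, rfl⟩
      exact hlt.asymm hkl

lemma permGL_one : (permGL 1 : GLn n) = 1 := by
  ext i j
  simp only [permGL, of_apply, Equiv.Perm.one_apply, Units.val_one, one_apply]
  congr

lemma permGL_conj_injective {w w' : Equiv.Perm (Fin n)}
    (h : conjSubgroup (permGL w) (stdBorel n) = conjSubgroup (permGL w') (stdBorel n)) :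
    w = w' := by
  have h1 : ∀ {i j}, w⁻¹ i < w⁻¹ j → w'⁻¹ i < w'⁻¹ j := by
    intro i j hij
    have hne : i ≠ j := by
      rintro rfl
      exact lt_irrefl _ hij
    rw [← rootElt_mem_permGL hne] at hij ⊢
    rwa [← h]
  have : w'⁻¹ * w = 1 := by
    apply perm_eq_one_of_strictMonoOn_classes (fun _ => ()) _ (fun _ => rfl)
    intro i j hij _
    exact h1 (by simpa using hij)
  rw [inv_mul_eq_one] at this
  exact this.symm

/-- The upper triangular group is its own normalizer. -/
lemma mem_stdBorel_of_conjSubgroup_eq {h : GLn n}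
    (hh : conjSubgroup h (stdBorel n) = stdBorel n) : h ∈ stdBorel n := by
  have hT : stdTorus n ≤ stdBorel n := fun t ht => mem_stdBorel.2 fun i j hij => ht hij.ne'
  obtain ⟨w, b, hb, t, ht, e⟩ := exists_perm_of_stdTorus_le (a := h) (by rwa [hh])
  have hw : w = 1 := by
    apply permGL_conj_injective
    have hP : permGL w = t⁻¹ * (h * b) := by rw [← e]; group
    rw [hP, ← conjSubgroup_conjSubgroup, ← conjSubgroup_conjSubgroup, conjSubgroup_eq_self hb, hh,
      conjSubgroup_eq_self ((stdBorel n).inv_mem (hT ht)), permGL_one,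
      conjSubgroup_eq_self (one_mem _)]
  rw [hw, permGL_one, mul_one] at e
  rw [← (stdBorel n).mul_mem_cancel_right hb, ← e]
  exact hT ht

lemma conjSubgroup_eq_iff {a a' : GLn n} :
    conjSubgroup a (stdBorel n) = conjSubgroup a' (stdBorel n) ↔ a⁻¹ * a' ∈ stdBorel n := by
  constructor
  · intro h
    apply mem_stdBorel_of_conjSubgroup_eq
    rw [← conjSubgroup_conjSubgroup, ← h, conjSubgroup_conjSubgroup, inv_mul_cancel,
      conjSubgroup_eq_self (one_mem _)]
  · intro h
    rw [← conjSubgroup_eq_self h, conjSubgroup_conjSubgroup, mul_inv_cancel_left,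
      conjSubgroup_eq_self h]

/-! ### Nilradicals and the nilpotent cone -/

lemma Ad_mem_nilradical {h : GLn n} {x : Mat n} {H : Subgroup (GLn n)} (hx : x ∈ nilradical H) :
    Ad h x ∈ nilradical (conjSubgroup h H) := by
  obtain ⟨g, rfl, hg⟩ := hx
  refine ⟨h * g, conjSubgroup_conjSubgroup _ _ _, fun i j hij => ?_⟩
  rw [_root_.mul_inv_rev, Ad_mul, Ad_inv_Ad]
  exact hg i j hij

lemma image_Ad_nilradical (h : GLn n) (H : Subgroup (GLn n)) :
    Ad h '' nilradical H = nilradical (conjSubgroup h H) := by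
  apply Set.Subset.antisymm
  · rintro _ ⟨x, hx, rfl⟩
    exact Ad_mem_nilradical hx
  · intro x hx
    refine ⟨Ad h⁻¹ x, ?_, Ad_Ad_inv h x⟩
    have := Ad_mem_nilradical (h := h⁻¹) hx
    rwa [conjSubgroup_conjSubgroup, inv_mul_cancel, conjSubgroup_eq_self (one_mem _)] at this

lemma zero_mem_nilradical {H : Subgroup (GLn n)} (hH : IsBorel H) : (0 : Mat n) ∈ nilradical H := by
  obtain ⟨g, rfl⟩ := hH
  exact ⟨g, rfl, fun i j _ => by simp [Ad]⟩

lemma smul_mem_nilradical {x : Mat n} {H : Subgroup (GLn n)} (c : ℂ) (hx : x ∈ nilradical H) :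
    c • x ∈ nilradical H := by
  obtain ⟨g, hg, h⟩ := hx
  exact ⟨g, hg, fun i j hij => by rw [Ad_smul, Matrix.smul_apply, h i j hij, smul_zero]⟩

lemma zero_mem_nilcone (s : GLn n) (q₀ : ℂˣ) : (0 : Mat n) ∈ nilcone s q₀ :=
  ⟨IsNilpotent.zero, by simp [Ad]⟩

lemma smul_mem_nilcone {s : GLn n} {q₀ : ℂˣ} {x : Mat n} (c : ℂ) (hx : x ∈ nilcone s q₀) :
    c • x ∈ nilcone s q₀ :=
  ⟨hx.1.smul c, by rw [Ad_smul, hx.2, smul_comm]⟩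

lemma Ad_mem_nilcone {s : GLn n} {q₀ : ℂˣ} {h : GLn n} (hh : h ∈ centr s) {x : Mat n}
    (hx : x ∈ nilcone s q₀) : Ad h x ∈ nilcone s q₀ := by
  refine ⟨?_, ?_⟩
  · obtain ⟨k, hk⟩ := hx.1
    refine ⟨k, ?_⟩
    rw [Ad, Units.conj_pow, hk, mul_zero, zero_mul]
  · rw [← Ad_mul, ← mem_centr.1 hh, Ad_mul, hx.2, Ad_smul]

/-! ### The Borel subgroups containing `s` -/

lemma twistBorel_eq {g : GLn n} {T B : Subgroup (GLn n)} (hA : IsAdapted g T B)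
    (w : Equiv.Perm (Fin n)) :
    twistBorel g w B = conjSubgroup (g * permGL w) (stdBorel n) := by
  rw [twistBorel, hA.2, conjSubgroup_conjSubgroup, weylLift, inv_mul_cancel_right]

lemma fibre_eq (g : GLn n) (w : Equiv.Perm (Fin n)) (B : Subgroup (GLn n)) (s : GLn n)
    (q₀ : ℂˣ) : fibre g w B s q₀ = nilradical (twistBorel g w B) ∩ nilcone s q₀ := by
  rw [fibre, image_Ad_nilradical, twistBorel]

lemma mem_conjSubgroup_mul_permGL {g x : GLn n} {w : Equiv.Perm (Fin n)} :
    x ∈ conjSubgroup (g * permGL w) (stdBorel n) ↔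
      ∀ i j, w⁻¹ j < w⁻¹ i → ((g⁻¹ * x * g : GLn n) : Mat n) i j = 0 := by
  rw [← conjSubgroup_conjSubgroup, mem_conjSubgroup, mem_conjSubgroup_permGL]

lemma val_conj_eq_diagonal {g s : GLn n} (hs : s ∈ conjSubgroup g (stdTorus n)) :
    ((g⁻¹ * s * g : GLn n) : Mat n) = diagonal (eigs g s) := by
  have h : IsDiag ((g⁻¹ * s * g : GLn n) : Mat n) := mem_conjSubgroup.1 hs
  exact h.diagonal_diag.symm

/-- In the basis `g`, the centralizer of `s` consists of the matrices with zero entries between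
different eigenvalues of `s`. -/
lemma mem_centr_iff {g s : GLn n} (hs : s ∈ conjSubgroup g (stdTorus n)) {x : GLn n} :
    x ∈ centr s ↔
      ∀ i j, eigs g s i ≠ eigs g s j → ((g⁻¹ * x * g : GLn n) : Mat n) i j = 0 := by
  have h1 : x ∈ centr s ↔ (g⁻¹ * x * g) * (g⁻¹ * s * g) = (g⁻¹ * s * g) * (g⁻¹ * x * g) := by
    rw [mem_centr]
    constructor
    · intro h
      calc _ = g⁻¹ * (x * s) * g := by group
        _ = _ := by rw [h]; group
    · intro h
      calc x * s = g * ((g⁻¹ * x * g) * (g⁻¹ * s * g)) * g⁻¹ := by group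
        _ = _ := by rw [h]; group
  rw [h1, Units.ext_iff, Units.val_mul, Units.val_mul (g⁻¹ * s * g), val_conj_eq_diagonal hs,
    ← Matrix.ext_iff]
  simp only [mul_diagonal, diagonal_mul]
  refine forall₂_congr fun i j => ?_
  rw [mul_comm, ← sub_eq_zero, ← sub_mul, mul_eq_zero, sub_eq_zero, eq_comm, or_iff_not_imp_left]

lemma stdTorus_le_conj_permGL {g : GLn n} (w : Equiv.Perm (Fin n)) :
    conjSubgroup g (stdTorus n) ≤ conjSubgroup (g * permGL w) (stdBorel n) := by
  intro t ht
  rw [mem_conjSubgroup_mul_permGL]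
  rw [mem_conjSubgroup] at ht
  intro i j hij
  exact ht fun e => by simp [e] at hij

lemma mul_comm_of_mem_conj_stdTorus {g s t : GLn n} (hs : s ∈ conjSubgroup g (stdTorus n))
    (ht : t ∈ conjSubgroup g (stdTorus n)) : t ∈ centr s := by
  rw [mem_centr_iff hs]
  intro i j hij
  exact mem_conjSubgroup.1 ht fun e => hij (by rw [e])

/-- The intersection of `^wB` with the centralizer of `s` only depends on the order in which `w⁻¹`
lists each set of indices with equal eigenvalue; these orders are the standard ones if and only if
`w` has minimal length in its coset. -/
lemma twist_inf_centr_eq_iff {g s : GLn n} (hs : s ∈ conjSubgroup g (stdTorus n))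
    {w : Equiv.Perm (Fin n)} :
    conjSubgroup (g * permGL w) (stdBorel n) ⊓ centr s = conjSubgroup g (stdBorel n) ⊓ centr s ↔
      w ∈ minReps g s := by
  rw [mem_minReps_iff]
  have hg : conjSubgroup g (stdBorel n) = conjSubgroup (g * permGL 1) (stdBorel n) := by
    rw [permGL_one, mul_one]
  rw [hg]
  constructor
  · intro h i j hij hd
    have h1 : g * rootElt i j hij.ne * g⁻¹ ∈
        conjSubgroup (g * permGL 1) (stdBorel n) ⊓ centr s := by
      refine Subgroup.mem_inf.2 ⟨?_, ?_⟩
      · rw [← conjSubgroup_conjSubgroup, mem_conjSubgroup]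
        simpa [mul_assoc] using (rootElt_mem_permGL hij.ne (w := 1)).2 (by simpa using hij)
      · rw [mem_centr_iff hs]
        intro k l hkl
        have : g⁻¹ * (g * rootElt i j hij.ne * g⁻¹) * g = rootElt i j hij.ne := by group
        rw [this]
        apply rootElt_apply_of_ne
        · rintro rfl
          exact hkl rfl
        · rintro ⟨rfl, rfl⟩
          exact hkl hd
    rw [← h] at h1
    have h2 := (Subgroup.mem_inf.1 h1).1
    rw [← conjSubgroup_conjSubgroup, mem_conjSubgroup] at h2
    rw [← rootElt_mem_permGL hij.ne]
    simpa [mul_assoc] using h2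
  · intro h
    ext x
    simp only [Subgroup.mem_inf, mem_conjSubgroup_mul_permGL, mem_centr_iff hs, inv_one,
      Equiv.Perm.one_apply]
    constructor
    · rintro ⟨h1, h2⟩
      refine ⟨fun i j hij => ?_, h2⟩
      by_cases hd : eigs g s i = eigs g s j
      · exact h1 _ _ (h _ _ hij hd.symm)
      · exact h2 _ _ hd
    · rintro ⟨h1, h2⟩
      refine ⟨fun i j hij => ?_, h2⟩
      by_cases hd : eigs g s i = eigs g s j
      · refine h1 _ _ ?_
        by_contra hlt
        rcases (not_lt.1 hlt).lt_or_eq with h3 | h3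
        · exact (h _ _ h3 hd).asymm hij
        · simp [h3] at hij
      · exact h2 _ _ hd

lemma exists_isAdapted {T B : Subgroup (GLn n)} (hB : IsBorel B) (hT : IsMaximalTorus T)
    (hTB : T ≤ B) : ∃ g, IsAdapted g T B := by
  obtain ⟨k, rfl⟩ := hT
  obtain ⟨h, rfl⟩ := hB
  obtain ⟨w, b, hb, t, ht, e⟩ := exists_perm_of_stdTorus_le (a := k⁻¹ * h) (by
    intro t ht
    have h1 : k * t * k⁻¹ ∈ conjSubgroup k (stdTorus n) := by
      rw [mem_conjSubgroup]
      simpa [mul_assoc] using ht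
    rw [← conjSubgroup_conjSubgroup, mem_conjSubgroup]
    simpa using hTB h1)
  refine ⟨k * (t * permGL w), ?_, ?_⟩
  · rw [← conjSubgroup_conjSubgroup]
    congr 1
    rw [← conjSubgroup_conjSubgroup]
    have : conjSubgroup (permGL w) (stdTorus n) = stdTorus n := by
      ext x
      rw [mem_conjSubgroup]
      change IsDiag _ ↔ IsDiag _
      simp only [IsDiag, Pairwise, Units.val_mul, mul_permGL_apply, permGL_inv_mul_apply]
      constructor
      · intro hx i j hij
        simpa using hx (i := w⁻¹ i) (j := w⁻¹ j) (w⁻¹.injective.ne hij)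
      · intro hx i j hij
        exact hx (w.injective.ne hij)
    rw [this, conjSubgroup_eq_self ht]
  · rw [e, ← mul_assoc, mul_inv_cancel_left, ← conjSubgroup_conjSubgroup,
      conjSubgroup_eq_self hb]

/-- The Borel subgroups containing the torus `T` are the `^wB`. -/
lemma exists_perm_of_torus_le {g : GLn n} {B' : Subgroup (GLn n)} (hB' : IsBorel B')
    (h : conjSubgroup g (stdTorus n) ≤ B') :
    ∃ w : Equiv.Perm (Fin n), B' = conjSubgroup (g * permGL w) (stdBorel n) := by
  obtain ⟨a, rfl⟩ := hB'
  obtain ⟨w, b, hb, t, ht, e⟩ := exists_perm_of_stdTorus_le (a := g⁻¹ * a) (by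
    intro t ht
    have h1 : g * t * g⁻¹ ∈ conjSubgroup g (stdTorus n) := by
      rw [mem_conjSubgroup]
      simpa [mul_assoc] using ht
    rw [← conjSubgroup_conjSubgroup, mem_conjSubgroup]
    simpa using h h1)
  refine ⟨w, ?_⟩
  have ht' : t ∈ conjSubgroup (permGL w) (stdBorel n) := by
    rw [mem_conjSubgroup_permGL]
    intro i j hij
    exact ht fun e => by simp [e] at hij
  rw [← conjSubgroup_conjSubgroup, ← conjSubgroup_eq_self ht', conjSubgroup_conjSubgroup t, e,
    conjSubgroup_conjSubgroup, ← mul_assoc, mul_inv_cancel_left, ← conjSubgroup_conjSubgroup,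
    conjSubgroup_eq_self hb]

lemma setOf_torus_le_eq {g s : GLn n} {T B : Subgroup (GLn n)} (hA : IsAdapted g T B)
    (hs : s ∈ T) :
    {B' | IsBorel B' ∧ T ≤ B' ∧ B' ⊓ centr s = B ⊓ centr s} =
      (fun w => twistBorel g w B) '' minReps g s := by
  have hs' := hA.1 ▸ hs
  ext B'
  simp only [Set.mem_image, twistBorel_eq hA]
  rw [hA.1, hA.2]
  constructor
  · rintro ⟨h1, h2, h3⟩
    obtain ⟨w, rfl⟩ := exists_perm_of_torus_le h1 h2
    exact ⟨w, (twist_inf_centr_eq_iff hs').1 h3, rfl⟩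
  · rintro ⟨w, hw, rfl⟩
    exact ⟨⟨_, rfl⟩, stdTorus_le_conj_permGL w, (twist_inf_centr_eq_iff hs').2 hw⟩

lemma setOf_mem_borel_eq {g s : GLn n} {T B : Subgroup (GLn n)} (hA : IsAdapted g T B)
    (hs : s ∈ T) :
    {B' | IsBorel B' ∧ s ∈ B' ∧ B' ⊓ centr s = B ⊓ centr s} =
      {B' | IsBorel B' ∧ T ≤ B' ∧ B' ⊓ centr s = B ⊓ centr s} := by
  ext B'
  refine ⟨fun h => ⟨h.1, fun t ht => ?_, h.2.2⟩, fun h => ⟨h.1, h.2.1 hs, h.2.2⟩⟩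
  -- `T` is contained in `B(s) = B'(s)`
  have h1 : t ∈ B ⊓ centr s := by
    rw [hA.1] at hs ht
    refine ⟨?_, mul_comm_of_mem_conj_stdTorus hs ht⟩
    have := stdTorus_le_conj_permGL 1 ht
    rwa [permGL_one, mul_one, ← hA.2] at this
  rw [← h.2.2] at h1
  exact h1.1

lemma injOn_twistBorel {g s : GLn n} {T B : Subgroup (GLn n)} (hA : IsAdapted g T B) :
    Set.InjOn (fun w => twistBorel g w B) (minReps g s) := by
  intro w _ w' _ h
  simp only [twistBorel_eq hA] at h
  apply permGL_conj_injective
  have := congrArg (conjSubgroup g⁻¹) h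
  simpa only [conjSubgroup_conjSubgroup, inv_mul_cancel_left] using this

/-! ### The orbits of the centralizer on the flags fixed by `s` -/

/-- A global linear section over the set of flags on whose subquotients `s` acts by the eigenvalues
permuted by `w`: for `a` with this property, `secMat g s w a` lies in the centralizer of `s` and
moves the flag of `g * permGL w` to that of `a`. -/
def secMat (g s : GLn n) (w : Equiv.Perm (Fin n)) (a : Mat n) : Mat n :=
  (g : Mat n) * mask (eigs g s) (((g⁻¹ : GLn n) : Mat n) * a * ((permGL w)⁻¹ : GLn n)) *
    ((g⁻¹ : GLn n) : Mat n)

lemma exists_centr_eq_secMat {g s : GLn n} (hs : s ∈ conjSubgroup g (stdTorus n)) {a : GLn n}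
    {w : Equiv.Perm (Fin n)} (ha : s ∈ conjSubgroup a (stdBorel n))
    (hw : ∀ i, eigs a s i = eigs g s (w i)) :
    ∃ h ∈ centr s, (h : Mat n) = secMat g s w a ∧
      ∃ b ∈ stdBorel n, h * (g * permGL w) = a * b := by
  set d := eigs g s with hd
  have e : (((g⁻¹ * a)⁻¹ : GLn n) : Mat n) * diagonal d * ((g⁻¹ * a : GLn n) : Mat n) =
      ((a⁻¹ * s * a : GLn n) : Mat n) := by
    rw [hd, ← val_conj_eq_diagonal hs, ← Units.val_mul, ← Units.val_mul]
    congr 1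
    group
  have hu := mem_conjSubgroup.1 ha
  obtain ⟨b, hb, hab⟩ := exists_mask_mul_permGL d (g⁻¹ * a) w
    (by rw [e]; exact hu) (by rw [e]; exact hw)
  have hM := eq_mul_of_mask hab
  refine ⟨g * (g⁻¹ * a * b * (permGL w)⁻¹) * g⁻¹, ?_, ?_, b, hb, by group⟩
  · rw [mem_centr_iff hs]
    have : g⁻¹ * (g * (g⁻¹ * a * b * (permGL w)⁻¹) * g⁻¹) * g =
        g⁻¹ * a * b * (permGL w)⁻¹ := by group
    rw [this, ← hM]
    intro i j hij
    exact if_neg hij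
  · rw [Units.val_mul, Units.val_mul g, ← hM, secMat, Units.val_mul]

lemma eigs_mul_of_mem_stdBorel {a s b : GLn n} (ha : s ∈ conjSubgroup a (stdBorel n))
    (hb : b ∈ stdBorel n) (i : Fin n) : eigs (a * b) s i = eigs a s i := by
  have h := stdBorel_conj_apply_self hb (mem_conjSubgroup.1 ha) i
  have e : (a * b)⁻¹ * s * (a * b) = b⁻¹ * (a⁻¹ * s * a) * b := by group
  unfold eigs
  rw [e]
  exact h

lemma eigs_centr_mul {g s h : GLn n} (hh : h ∈ centr s) (i : Fin n) :
    eigs (h * g) s i = eigs g s i := by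
  have e : (h * g)⁻¹ * s * (h * g) = g⁻¹ * s * g := by
    have := mem_centr.1 hh
    calc _ = g⁻¹ * (h⁻¹ * (s * h)) * g := by group
      _ = _ := by rw [← this]; group
  unfold eigs
  rw [e]

lemma eigs_mul_permGL (g s : GLn n) (w : Equiv.Perm (Fin n)) (i : Fin n) :
    eigs (g * permGL w) s i = eigs g s (w i) := by
  have e : (g * permGL w)⁻¹ * s * (g * permGL w) =
      (permGL w)⁻¹ * (g⁻¹ * s * g) * permGL w := by group
  unfold eigs
  rw [e, Units.val_mul, Units.val_mul, mul_permGL_apply, permGL_inv_mul_apply]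

/-- The flags on whose subquotients `s` acts by the eigenvalues permuted by `w` form the orbit of
`^wB` under the centralizer of `s`. -/
lemma exists_centr_conj_eq_iff {g s : GLn n} (hs : s ∈ conjSubgroup g (stdTorus n)) {a : GLn n}
    {w : Equiv.Perm (Fin n)} (ha : s ∈ conjSubgroup a (stdBorel n)) :
    (∃ h ∈ centr s, conjSubgroup h (conjSubgroup (g * permGL w) (stdBorel n)) =
      conjSubgroup a (stdBorel n)) ↔ ∀ i, eigs a s i = eigs g s (w i) := by
  constructor
  · rintro ⟨h, hh, e⟩ i
    rw [conjSubgroup_conjSubgroup, conjSubgroup_eq_iff] at e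
    have hsw : s ∈ conjSubgroup (h * (g * permGL w)) (stdBorel n) := by
      rwa [conjSubgroup_eq_iff.2 e]
    have h1 := eigs_mul_of_mem_stdBorel hsw e i
    rw [mul_inv_cancel_left] at h1
    rw [h1, eigs_centr_mul hh, eigs_mul_permGL]
  · intro hw
    obtain ⟨h, hh, -, b, hb, e⟩ := exists_centr_eq_secMat hs ha hw
    refine ⟨h, hh, ?_⟩
    rw [conjSubgroup_conjSubgroup, e, ← conjSubgroup_conjSubgroup, conjSubgroup_eq_self hb]

lemma exists_minReps_eigs_eq {g s : GLn n} (hs : s ∈ conjSubgroup g (stdTorus n)) {a : GLn n}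
    (ha : s ∈ conjSubgroup a (stdBorel n)) :
    ∃ w ∈ minReps g s, ∀ i, eigs a s i = eigs g s (w i) := by
  have e : (((g⁻¹ * a)⁻¹ : GLn n) : Mat n) * diagonal (eigs g s) * ((g⁻¹ * a : GLn n) : Mat n) =
      ((a⁻¹ * s * a : GLn n) : Mat n) := by
    rw [← val_conj_eq_diagonal hs, ← Units.val_mul, ← Units.val_mul]
    congr 1
    group
  obtain ⟨w, hw⟩ := exists_perm_diag_eq (eigs g s) (g⁻¹ * a)
    (by rw [e]; exact mem_conjSubgroup.1 ha)
  rw [e] at hw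
  obtain ⟨w', hw', h⟩ := exists_minReps_comp_eq g s w
  exact ⟨w', hw', fun i => (hw i).trans (h i).symm⟩

/-! ### Locally rational functions -/

section LocRat

variable {Z Z' κ κ' : Type*}

/-- The functions on `Z ⊆ ℂ^κ` that are a quotient of polynomials on a Zariski neighbourhood
of `z`. -/
def locRat (c : Z → κ → ℂ) (z : Z) : Subalgebra ℂ (Z → ℂ) where
  carrier := {F | ∃ p r : MvPolynomial κ ℂ, MvPolynomial.eval (c z) r ≠ 0 ∧
    ∀ z', MvPolynomial.eval (c z') r ≠ 0 →
      F z' = MvPolynomial.eval (c z') p / MvPolynomial.eval (c z') r}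
  mul_mem' := by
    rintro F F' ⟨p, r, h0, h⟩ ⟨p', r', h0', h'⟩
    refine ⟨p * p', r * r', by simp [h0, h0'], fun z' hz' => ?_⟩
    rw [map_mul] at hz'
    rw [Pi.mul_apply, h _ (left_ne_zero_of_mul hz'), h' _ (right_ne_zero_of_mul hz'), map_mul,
      map_mul, div_mul_div_comm]
  add_mem' := by
    rintro F F' ⟨p, r, h0, h⟩ ⟨p', r', h0', h'⟩
    refine ⟨p * r' + r * p', r * r', by simp [h0, h0'], fun z' hz' => ?_⟩
    rw [map_mul] at hz'
    rw [Pi.add_apply, h _ (left_ne_zero_of_mul hz'), h' _ (right_ne_zero_of_mul hz'), map_mul,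
      map_add, map_mul, map_mul,
      div_add_div _ _ (left_ne_zero_of_mul hz') (right_ne_zero_of_mul hz')]
  algebraMap_mem' a := ⟨MvPolynomial.C a, 1, by simp, fun z' _ => by simp⟩

lemma const_mem_locRat (c : Z → κ → ℂ) (z : Z) (a : ℂ) : (fun _ => a) ∈ locRat c z :=
  (locRat c z).algebraMap_mem a

lemma coord_mem_locRat (c : Z → κ → ℂ) (z : Z) (k : κ) : (fun z' => c z' k) ∈ locRat c z :=
  ⟨MvPolynomial.X k, 1, by simp, fun z' _ => by simp⟩

lemma inv_mem_locRat {c : Z → κ → ℂ} {z : Z} {F : Z → ℂ} (hF : F ∈ locRat c z) (h0 : F z ≠ 0) :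
    F⁻¹ ∈ locRat c z := by
  obtain ⟨p, r, hr, h⟩ := hF
  have hp : MvPolynomial.eval (c z) p ≠ 0 := by
    rw [h z hr] at h0
    exact (div_ne_zero_iff.1 h0).1
  refine ⟨r * r, p * r, by simp [hp, hr], fun z' hz' => ?_⟩
  rw [map_mul] at hz'
  rw [Pi.inv_apply, h z' (right_ne_zero_of_mul hz'), map_mul, map_mul, inv_div,
    mul_div_mul_right _ _ (right_ne_zero_of_mul hz')]

lemma eval_mem_locRat {c : Z → κ → ℂ} {z : Z} {G : κ' → Z → ℂ} (hG : ∀ k, G k ∈ locRat c z)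
    (p : MvPolynomial κ' ℂ) :
    (fun z' => MvPolynomial.eval (fun k => G k z') p) ∈ locRat c z := by
  induction p using MvPolynomial.induction_on with
  | C a => simpa using const_mem_locRat c z a
  | add p q hp hq =>
    simp only [map_add]
    exact add_mem hp hq
  | mul_X p k hp =>
    simp only [map_mul, MvPolynomial.eval_X]
    exact mul_mem hp (hG k)

/-- Locally rational functions pull back to locally rational functions along a map that is only
defined on a Zariski neighbourhood `{r ≠ 0}` and has locally rational coordinates `G`. -/
lemma mem_locRat_of_comp {c : Z → κ → ℂ} {c' : Z' → κ' → ℂ} {F : Z → ℂ} {F' : Z' → ℂ} {z₀ : Z}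
    {z₀' : Z'} (hF' : F' ∈ locRat c' z₀') {G : κ' → Z → ℂ} (hG : ∀ k, G k ∈ locRat c z₀)
    (hz₀ : ∀ k, G k z₀ = c' z₀' k) {r : MvPolynomial κ ℂ} (hr : MvPolynomial.eval (c z₀) r ≠ 0)
    (h : ∀ z, MvPolynomial.eval (c z) r ≠ 0 → ∃ z', (∀ k, c' z' k = G k z) ∧ F z = F' z') :
    F ∈ locRat c z₀ := by
  obtain ⟨p', r', hr', hpr'⟩ := hF'
  have hP := eval_mem_locRat hG p'
  have hR := eval_mem_locRat hG r'
  have hR0 : MvPolynomial.eval (fun k => G k z₀) r' ≠ 0 := by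
    rwa [funext hz₀]
  obtain ⟨a, b, hb, hab⟩ := mul_mem hP (inv_mem_locRat hR hR0)
  obtain ⟨u, v, hv, huv⟩ := hR
  beta_reduce at huv
  have hu : MvPolynomial.eval (c z₀) u ≠ 0 := by
    rw [huv z₀ hv] at hR0
    exact (div_ne_zero_iff.1 hR0).1
  refine ⟨a * (r * u * v), b * (r * u * v), by simp [hb, hr, hu, hv], fun z hz => ?_⟩
  simp only [map_mul, mul_ne_zero_iff] at hz
  obtain ⟨hz1, ⟨hz2, hz3⟩, hz4⟩ := hz
  obtain ⟨z', hz', e⟩ := h z hz2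
  have hc : c' z' = fun k => G k z := funext hz'
  have hz5 : MvPolynomial.eval (c' z') r' ≠ 0 := by
    rw [hc, huv z hz4]
    exact div_ne_zero hz3 hz4
  have h1 := hab z hz1
  simp only [Pi.mul_apply, Pi.inv_apply, ← div_eq_mul_inv] at h1
  rw [e, hpr' z' hz5, hc, h1]
  simp only [map_mul]
  rw [mul_div_mul_right _ _ (mul_ne_zero (mul_ne_zero hz2 hz3) hz4)]

/-- Matrix-valued functions with locally rational entries. -/
def LocRatMat (c : Z → κ → ℂ) (z : Z) (A : Z → Mat n) : Prop :=
  ∀ i j, (fun z' => A z' i j) ∈ locRat c z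

variable {c : Z → κ → ℂ} {z : Z} {A C : Z → Mat n}

lemma LocRatMat.const (M : Mat n) : LocRatMat c z fun _ => M :=
  fun i j => const_mem_locRat c z (M i j)

lemma LocRatMat.mul (hA : LocRatMat c z A) (hC : LocRatMat c z C) :
    LocRatMat c z fun z' => A z' * C z' := by
  intro i j
  have : (fun z' => (A z' * C z') i j) = ∑ k, (fun z' => A z' i k) * fun z' => C z' k j := by
    ext z'
    simp [mul_apply]
  rw [this]
  exact sum_mem fun k _ => mul_mem (hA i k) (hC k j)

lemma LocRatMat.det (hA : LocRatMat c z A) : (fun z' => (A z').det) ∈ locRat c z := by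
  have : (fun z' => (A z').det) = ∑ σ : Equiv.Perm (Fin n),
      (fun _ => ((Equiv.Perm.sign σ : ℤ) : ℂ)) * ∏ i, fun z' => A z' (σ i) i := by
    ext z'
    simp [det_apply']
  rw [this]
  exact sum_mem fun σ _ => mul_mem (const_mem_locRat c z _) (prod_mem fun i _ => hA _ _)

lemma LocRatMat.inv (hA : LocRatMat c z A) (h0 : (A z).det ≠ 0) :
    LocRatMat c z fun z' => (A z')⁻¹ := by
  intro i j
  have hadj : (fun z' => (A z').adjugate i j) ∈ locRat c z := by
    simp only [adjugate_apply]
    refine LocRatMat.det (A := fun z' => (A z').updateRow j (Pi.single i 1)) fun k l => ?_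
    by_cases hk : k = j
    · subst hk
      simpa using const_mem_locRat c z (Pi.single (M := fun _ => ℂ) i 1 l)
    · simpa [updateRow_ne hk] using hA k l
  have : (fun z' => (A z')⁻¹ i j) = (fun z' => (A z').det)⁻¹ * fun z' => (A z').adjugate i j := by
    ext z'
    simp [inv_def]
  rw [this]
  exact mul_mem (inv_mem_locRat hA.det h0) hadj

lemma LocRatMat.mask (d : Fin n → ℂ) (hA : LocRatMat c z A) :
    LocRatMat c z fun z' => mask d (A z') := by
  intro i j
  by_cases h : d i = d j
  · simpa [SpringerFixed.mask, h] using hA i j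
  · simpa [SpringerFixed.mask, h] using const_mem_locRat c z 0

lemma LocRatMat.secMat (g s : GLn n) (w : Equiv.Perm (Fin n)) (hA : LocRatMat c z A) :
    LocRatMat c z fun z' => secMat g s w (A z') :=
  ((LocRatMat.const _).mul
    (LocRatMat.mask _ (((LocRatMat.const _).mul hA).mul (LocRatMat.const _)))).mul
    (LocRatMat.const _)

end LocRat

/-! ### The strata of the covering of `Ñ` -/

/-- The points of the covering of `Ñ^{(s,q₀)}` lying over the flags on whose subquotients `s` acts
by the eigenvalues permuted by `w`. -/
def stratum (g s : GLn n) (q₀ : ℂˣ) (w : Equiv.Perm (Fin n)) : Set (NTildeCover s q₀) :=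
  {z | ∀ i, eigs z.1.1 s i = eigs g s (w i)}

lemma NTildeCover.mem_conj {s : GLn n} {q₀ : ℂˣ} (z : NTildeCover s q₀) :
    s ∈ conjSubgroup z.1.1 (stdBorel n) := z.2.2.1

/-- Each stratum is a principal Zariski open set: since the `i`-th eigenvalue of `s` on the flag
of `a` is one of finitely many numbers, it is the right one as soon as it is none of the others, and
multiplying by `det a` makes this a polynomial condition. -/
lemma exists_poly_stratum {g s : GLn n} (q₀ : ℂˣ) (hs : s ∈ conjSubgroup g (stdTorus n))
    (w : Equiv.Perm (Fin n)) :
    ∃ r : MvPolynomial ((Fin n × Fin n) ⊕ (Fin n × Fin n)) ℂ, ∀ z : NTildeCover s q₀,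
      MvPolynomial.eval (NTildeCover.coord s q₀ z) r ≠ 0 ↔ z ∈ stratum g s q₀ w := by
  classical
  let A : Matrix (Fin n) (Fin n) (MvPolynomial ((Fin n × Fin n) ⊕ (Fin n × Fin n)) ℂ) :=
    Matrix.of fun i j => MvPolynomial.X (Sum.inl (i, j))
  let N : Matrix (Fin n) (Fin n) (MvPolynomial ((Fin n × Fin n) ⊕ (Fin n × Fin n)) ℂ) :=
    A.adjugate * (s : Mat n).map MvPolynomial.C * A
  refine ⟨∏ i, ∏ c ∈ (Finset.univ.image (eigs g s)).erase (eigs g s (w i)),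
    (N i i - MvPolynomial.C c * A.det),
    fun z => ?_⟩
  let ev := MvPolynomial.eval (NTildeCover.coord s q₀ z)
  have hA : ev.mapMatrix A = (z.1.1 : Mat n) := by
    ext i j
    simp [A, ev, NTildeCover.coord, pairCoord]
  have hdet : ev A.det = (z.1.1 : Mat n).det := by rw [RingHom.map_det, hA]
  have hdet0 : (z.1.1 : Mat n).det ≠ 0 :=
    det_val_ne_zero z.1.1
  have hs' : ev.mapMatrix ((s : Mat n).map MvPolynomial.C) = s := by
    ext i j
    simp [ev]
  have hent : ∀ i, ev (N i i) =
      (z.1.1 : Mat n).det * eigs z.1.1 s i := by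
    intro i
    have h1 : ev.mapMatrix N =
        (z.1.1 : Mat n).adjugate * (s : Mat n) * (z.1.1 : Mat n) := by
      rw [map_mul, map_mul, RingHom.map_adjugate, hA, hs']
    have h2 : (z.1.1 : Mat n).adjugate = (z.1.1 : Mat n).det • ((z.1.1⁻¹ : GLn n) : Mat n) := by
      rw [coe_units_inv, inv_def, smul_smul, Ring.mul_inverse_cancel _ hdet0.isUnit, one_smul]
    have h3 := congrFun (congrFun h1 i) i
    rw [h2, smul_mul_assoc, smul_mul_assoc] at h3
    exact h3
  change ev _ ≠ 0 ↔ _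
  rw [map_prod, Finset.prod_ne_zero_iff]
  simp only [map_prod, Finset.prod_ne_zero_iff, map_sub, map_mul, hent, hdet, Finset.mem_univ,
    true_imp_iff]
  refine forall_congr' fun i => ?_
  have hC : ∀ c, ev (MvPolynomial.C c) = c := fun c => MvPolynomial.eval_C c
  simp only [hC, mul_comm _ (z.1.1 : Mat n).det, ← mul_sub]
  obtain ⟨w', -, hw'⟩ := exists_minReps_eigs_eq hs z.mem_conj
  constructor
  · intro h
    by_contra hne
    apply h (eigs z.1.1 s i)
    · rw [Finset.mem_erase]
      exact ⟨hne, by rw [hw']; exact Finset.mem_image_of_mem _ (Finset.mem_univ _)⟩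
    · rw [sub_self, mul_zero]
  · intro h c hc
    rw [Finset.mem_erase] at hc
    rw [h]
    exact mul_ne_zero hdet0 (sub_ne_zero.2 hc.1.symm)

/-! ### Connected components and topologies -/

/-- A partition into open preconnected nonempty sets is the partition into connected components. -/
lemma bijOn_range_connectedComponent {Y ι : Type*} [TopologicalSpace Y] {R : ι → Set Y}
    (hne : ∀ i, (R i).Nonempty) (hpre : ∀ i, IsPreconnected (R i)) (hopen : ∀ i, IsOpen (R i))
    (hdisj : ∀ i j y, y ∈ R i → y ∈ R j → i = j) (hcov : ∀ y, ∃ i, y ∈ R i) :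
    Set.BijOn R Set.univ (Set.range fun y : Y => connectedComponent y) := by
  have hclopen : ∀ i, IsClopen (R i) := fun i => by
    refine ⟨⟨?_⟩, hopen i⟩
    have : (R i)ᶜ = ⋃ j, ⋃ _ : j ≠ i, R j := by
      ext y
      simp only [Set.mem_compl_iff, Set.mem_iUnion, exists_prop]
      constructor
      · intro hy
        obtain ⟨j, hj⟩ := hcov y
        exact ⟨j, fun e => hy (e ▸ hj), hj⟩
      · rintro ⟨j, hj, hy⟩ hy'
        exact hj (hdisj _ _ _ hy hy')
    rw [this]
    exact isOpen_iUnion fun j => isOpen_iUnion fun _ => hopen j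
  have heq : ∀ i, ∀ y ∈ R i, connectedComponent y = R i := fun i y hy =>
    Set.Subset.antisymm ((hclopen i).connectedComponent_subset hy)
      ((hpre i).subset_connectedComponent hy)
  refine ⟨fun i _ => ?_, fun i _ j _ h => ?_, ?_⟩
  · obtain ⟨y, hy⟩ := hne i
    exact ⟨y, heq i y hy⟩
  · obtain ⟨y, hy⟩ := hne i
    exact hdisj i j y hy (h ▸ hy)
  · rintro _ ⟨y, rfl⟩
    obtain ⟨i, hi⟩ := hcov y
    exact ⟨i, trivial, (heq i y hi).symm⟩

lemma continuous_of_continuous_val {X : Type*} [TopologicalSpace X] {f : X → GLn n}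
    (hf : Continuous fun x => (f x : Mat n)) : Continuous f := by
  rw [Units.continuous_iff]
  refine ⟨hf, ?_⟩
  have : (fun x => ((f x)⁻¹ : GLn n).val) =
      fun x => ((f x : Mat n).det)⁻¹ • (f x : Mat n).adjugate := by
    ext x
    rw [coe_units_inv, inv_def, Ring.inverse_eq_inv']
  rw [this]
  refine (hf.matrix_det.inv₀ fun x => ?_).smul hf.matrix_adjugate
  exact isUnit_iff_ne_zero.1 ((isUnit_iff_isUnit_det _).1 (f x).isUnit)

lemma continuous_Ad_comp {X : Type*} [TopologicalSpace X] {f : X → GLn n} {x : X → Mat n}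
    (hf : Continuous f) (hx : Continuous x) : Continuous fun y => Ad (f y) (x y) :=
  ((Units.continuous_val.comp hf).mul hx).mul (Units.continuous_val.comp hf.inv)

/-- The centralizer of `s` is connected: it is the intersection of `GL_n` with a linear subspace, so
any of its elements `h` is joined to `1` inside the complex line through `1` and `h`, in which only
finitely many points are not invertible. -/
lemma isPreconnected_univ_centr (s : GLn n) : IsPreconnected (Set.univ : Set (centr s)) := by
  refine isPreconnected_of_forall 1 fun h _ => ?_
  let L : ℂ → Mat n := fun c => 1 + c • (((h : GLn n) : Mat n) - 1)
  let P : Polynomial ℂ :=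
    (1 + (Polynomial.X : Polynomial ℂ) • ((((h : GLn n) : Mat n) - 1).map Polynomial.C)).det
  have hP : ∀ c, P.eval c = (L c).det := by
    intro c
    rw [← Polynomial.coe_evalRingHom, RingHom.map_det]
    congr 1
    ext i j
    simp [L, one_apply, apply_ite (Polynomial.eval c)]
  let S : Set ℂ := {c | (L c).det ≠ 0}
  have hS : IsPreconnected S := by
    have hcount : Sᶜ.Countable := by
      have hP0 : P ≠ 0 := by
        intro h0
        have := hP 0
        simp [h0, L] at this
      refine ((Polynomial.finite_setOfPred_isRoot hP0).subset fun c hc => ?_).countable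
      have hc' : (L c).det = 0 := not_not.1 hc
      rwa [← hP] at hc'
    have := hcount.isConnected_compl_of_one_lt_rank (by simp [Complex.rank_real_complex])
    rw [compl_compl] at this
    exact this.isPreconnected
  have hcomm : ∀ c, L c * (s : Mat n) = (s : Mat n) * L c := by
    intro c
    have hh : ((h : GLn n) : Mat n) * (s : Mat n) = (s : Mat n) * ((h : GLn n) : Mat n) :=
      congrArg Units.val (mem_centr.1 h.2)
    simp only [L, add_mul, mul_add, one_mul, mul_one, smul_mul_assoc, mul_smul_comm, sub_mul,
      mul_sub, hh]
  let F : S → centr s := fun c =>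
    ⟨GeneralLinearGroup.mk'' (L c) (isUnit_iff_ne_zero.2 c.2), mem_centr.2 (Units.ext (hcomm c))⟩
  have hF : Continuous F := by
    refine Continuous.subtype_mk (continuous_of_continuous_val ?_) _
    change Continuous fun c : S => 1 + (c : ℂ) • (((h : GLn n) : Mat n) - 1)
    exact continuous_const.add (continuous_subtype_val.smul continuous_const)
  have : PreconnectedSpace S := Subtype.preconnectedSpace hS
  refine ⟨Set.range F, Set.subset_univ _, ⟨⟨0, by simp [S, L]⟩, ?_⟩, ⟨⟨1, ?_⟩, ?_⟩,
    isPreconnected_range hF⟩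
  · apply Subtype.ext
    apply Units.ext
    change L 0 = 1
    simp [L]
  · change (L 1).det ≠ 0
    have : L 1 = ((h : GLn n) : Mat n) := by simp [L]
    rw [this]
    exact det_val_ne_zero (h : GLn n)
  · apply Subtype.ext
    apply Units.ext
    change L 1 = ((h : GLn n) : Mat n)
    simp [L]

/-- Both sets are stable under scalars, so their intersection is star-shaped around `0`. -/
lemma isPreconnected_nilradical_inter_nilcone {H : Subgroup (GLn n)} (hH : IsBorel H) (s : GLn n)
    (q₀ : ℂˣ) : IsPreconnected (nilradical H ∩ nilcone s q₀) := by
  have h0 : (0 : Mat n) ∈ nilradical H ∩ nilcone s q₀ :=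
    ⟨zero_mem_nilradical hH, zero_mem_nilcone s q₀⟩
  have hstar : StarConvex ℝ (0 : Mat n) (nilradical H ∩ nilcone s q₀) := by
    rw [starConvex_zero_iff]
    intro x hx a _ _
    have e : a • x = (a : ℂ) • x := by
      ext i j
      simp
    rw [e]
    exact ⟨smul_mem_nilradical _ hx.1, smul_mem_nilcone _ hx.2⟩
  exact (hstar.isPathConnected h0).isConnected.isPreconnected

/-! ### The analytic and the Zariski topology of `Ñ` -/

/-- The analytic topology of the covering of `Ñ^{(s,q₀)}`. -/
instance (s : GLn n) (q₀ : ℂˣ) : TopologicalSpace (NTildeCover s q₀) :=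
  instTopologicalSpaceSubtype

lemma FlagVariety.orbit_eq_iff {a a' : GLn n} :
    FlagVariety.orbit a = FlagVariety.orbit a' ↔ a⁻¹ * a' ∈ stdBorel n := by
  rw [← conjSubgroup_eq_iff]
  exact Subtype.ext_iff

lemma FlagVariety.continuous_orbit : Continuous (FlagVariety.orbit (n := n)) :=
  continuous_coinduced_rng

lemma FlagVariety.isOpenMap_orbit : IsOpenMap (FlagVariety.orbit (n := n)) := by
  intro U hU
  rw [isOpen_coinduced]
  have : FlagVariety.orbit ⁻¹' (FlagVariety.orbit '' U) =
      ⋃ b ∈ stdBorel n, (fun a : GLn n => a * b) ⁻¹' U := by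
    ext a
    simp only [Set.mem_preimage, Set.mem_image, Set.mem_iUnion, exists_prop]
    constructor
    · rintro ⟨a', ha', e⟩
      rw [eq_comm, FlagVariety.orbit_eq_iff] at e
      exact ⟨_, e, by rwa [mul_inv_cancel_left]⟩
    · rintro ⟨b, hb, h⟩
      refine ⟨a * b, h, ?_⟩
      rw [eq_comm, FlagVariety.orbit_eq_iff, inv_mul_cancel_left]
      exact hb
  rw [this]
  exact isOpen_biUnion fun b _ => hU.preimage (continuous_mul_const b)

lemma NTildeCover.proj_surjective (s : GLn n) (q₀ : ℂˣ) :
    Function.Surjective (NTildeCover.proj s q₀) := by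
  rintro ⟨⟨x, B', g, rfl⟩, h⟩
  exact ⟨⟨(g, x), h⟩, rfl⟩

lemma NTildeCover.isQuotientMap_proj (s : GLn n) (q₀ : ℂˣ) :
    Topology.IsQuotientMap (NTildeCover.proj s q₀) := by
  let p : GLn n × Mat n → Mat n × FlagVariety n := fun a => (a.2, FlagVariety.orbit a.1)
  have hp : IsOpenMap p := by
    have : p = Prod.map id FlagVariety.orbit ∘ Prod.swap := rfl
    rw [this]
    exact (IsOpenMap.id.prodMap FlagVariety.isOpenMap_orbit).comp
      (Homeomorph.prodComm _ _).isOpenMap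
  have hpc : Continuous p :=
    continuous_snd.prodMk (FlagVariety.continuous_orbit.comp continuous_fst)
  have h := hp.restrictPreimage (NTilde s q₀)
  exact IsOpenMap.isQuotientMap h (hpc.restrictPreimage (s := NTilde s q₀))
    (NTildeCover.proj_surjective s q₀)

lemma isOpen_eval_coord_ne_zero (s : GLn n) (q₀ : ℂˣ)
    (r : MvPolynomial ((Fin n × Fin n) ⊕ (Fin n × Fin n)) ℂ) :
    IsOpen {z | MvPolynomial.eval (NTildeCover.coord s q₀ z) r ≠ 0} := by
  have hc : Continuous (NTildeCover.coord s q₀) := by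
    refine continuous_pi fun k => ?_
    rcases k with ⟨i, j⟩ | ⟨i, j⟩
    · have h : Continuous fun z : NTildeCover s q₀ => (z.1.1 : Mat n) :=
        Units.continuous_val.comp (continuous_fst.comp continuous_subtype_val)
      exact h.matrix_elem i j
    · have h : Continuous fun z : NTildeCover s q₀ => z.1.2 :=
        continuous_snd.comp continuous_subtype_val
      exact h.matrix_elem i j
  exact isOpen_ne_fun ((MvPolynomial.continuous_eval r).comp hc) continuous_const

lemma analytic_le_zariski (s : GLn n) (q₀ : ℂˣ) :
    (inferInstance : TopologicalSpace (NTilde s q₀)) ≤ NTilde.zariski s q₀ := by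
  rw [(NTildeCover.isQuotientMap_proj s q₀).eq_coinduced]
  apply coinduced_mono
  apply le_generateFrom
  rintro _ ⟨p, rfl⟩
  exact isOpen_eval_coord_ne_zero s q₀ p

lemma isOpen_zariski_of_preimage_eq_stratum {g s : GLn n} {q₀ : ℂˣ}
    (hs : s ∈ conjSubgroup g (stdTorus n)) {w : Equiv.Perm (Fin n)} {R : Set (NTilde s q₀)}
    (hR : NTildeCover.proj s q₀ ⁻¹' R = stratum g s q₀ w) : @IsOpen _ (NTilde.zariski s q₀) R := by
  rw [isOpen_coinduced, hR]
  obtain ⟨r, hr⟩ := exists_poly_stratum q₀ hs w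
  exact TopologicalSpace.isOpen_generateFrom_of_mem ⟨r, Set.ext fun z => (hr z).symm⟩

lemma isOpen_stratum {g s : GLn n} {q₀ : ℂˣ} (hs : s ∈ conjSubgroup g (stdTorus n))
    (w : Equiv.Perm (Fin n)) : IsOpen (stratum g s q₀ w) := by
  obtain ⟨r, hr⟩ := exists_poly_stratum q₀ hs w
  rw [show stratum g s q₀ w = _ from Set.ext fun z => (hr z).symm]
  exact isOpen_eval_coord_ne_zero s q₀ r

/-! ### The maps from the associated bundles -/

section Bundle

variable {s : GLn n} {q₀ : ℂˣ} {m : GLn n} {H : Subgroup (GLn n)} {V : Set (Mat n)}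

lemma Ad_mk_mem_NTilde (hm : s ∈ conjSubgroup m (stdBorel n))
    (hV : V = nilradical (conjSubgroup m (stdBorel n)) ∩ nilcone s q₀) (a : centr s × V) :
    (Ad a.1 a.2, FlagVariety.orbit ((a.1 : GLn n) * m)) ∈ NTilde s q₀ := by
  have hx : (a.2 : Mat n) ∈ nilradical (conjSubgroup m (stdBorel n)) ∩ nilcone s q₀ :=
    hV ▸ a.2.2
  refine ⟨Ad_mem_nilcone a.1.2 hx.2, ?_, ?_⟩
  · change s ∈ conjSubgroup _ _
    rw [← conjSubgroup_conjSubgroup, mem_conjSubgroup]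
    have : (a.1 : GLn n)⁻¹ * s * a.1 = s := by
      rw [mul_assoc, ← mem_centr.1 a.1.2, inv_mul_cancel_left]
    rwa [this]
  · change _ ∈ nilradical (conjSubgroup _ _)
    rw [← conjSubgroup_conjSubgroup]
    exact Ad_mem_nilradical hx.1

/-- The map `(h, x) ↦ (h x h⁻¹, h B' h⁻¹)` for the Borel subgroup `B' = m B₀ m⁻¹`, where `B₀` is the
upper triangular group. -/
def bundlePreMap (hm : s ∈ conjSubgroup m (stdBorel n))
    (hV : V = nilradical (conjSubgroup m (stdBorel n)) ∩ nilcone s q₀) (a : centr s × V) :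
    NTilde s q₀ :=
  ⟨(Ad a.1 a.2, FlagVariety.orbit ((a.1 : GLn n) * m)), Ad_mk_mem_NTilde hm hV a⟩

lemma bundlePreMap_eq_iff (hm : s ∈ conjSubgroup m (stdBorel n))
    (hV : V = nilradical (conjSubgroup m (stdBorel n)) ∩ nilcone s q₀)
    (hH : H = conjSubgroup m (stdBorel n) ⊓ centr s) (a a' : centr s × V) :
    bundlePreMap hm hV a = bundlePreMap hm hV a' ↔ assocSetoid (centr s) H V a a' := by
  have h1 : bundlePreMap hm hV a = bundlePreMap hm hV a' ↔
      Ad (a.1 : GLn n) (a.2 : Mat n) = Ad (a'.1 : GLn n) (a'.2 : Mat n) ∧ (a'.1 : GLn n)⁻¹ * a.1 ∈ conjSubgroup m (stdBorel n) := by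
    rw [bundlePreMap, bundlePreMap, Subtype.mk_eq_mk, Prod.mk.injEq]
    apply and_congr_right
    intro _
    rw [eq_comm, FlagVariety.orbit_eq_iff, mem_conjSubgroup]
    simp only [_root_.mul_inv_rev, mul_assoc]
  rw [h1]
  constructor
  · rintro ⟨hx, hb⟩
    refine ⟨(a'.1 : GLn n)⁻¹ * a.1, ?_, by group, ?_⟩
    · rw [hH]
      exact Subgroup.mem_inf.2 ⟨hb, mul_mem (inv_mem a'.1.2) a.1.2⟩
    · rw [Ad_mul, hx, Ad_inv_Ad]
  · rintro ⟨b, hb, e1, e2⟩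
    rw [hH] at hb
    refine ⟨?_, ?_⟩
    · rw [e1, e2, Ad_mul, Ad_inv_Ad]
    · rw [e1]
      simpa using (Subgroup.mem_inf.1 hb).1

/-- The map `[h, x] ↦ (h x h⁻¹, h B' h⁻¹)` for the Borel subgroup `B' = m B₀ m⁻¹`, where `B₀` is the
upper triangular group. -/
def bundleMap (hm : s ∈ conjSubgroup m (stdBorel n))
    (hV : V = nilradical (conjSubgroup m (stdBorel n)) ∩ nilcone s q₀)
    (hH : H = conjSubgroup m (stdBorel n) ⊓ centr s) : AssocBundle (centr s) H V → NTilde s q₀ :=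
  Quotient.lift (bundlePreMap hm hV) fun a a' h => (bundlePreMap_eq_iff hm hV hH a a').2 h

variable (hm : s ∈ conjSubgroup m (stdBorel n))
  (hV : V = nilradical (conjSubgroup m (stdBorel n)) ∩ nilcone s q₀)
  (hH : H = conjSubgroup m (stdBorel n) ⊓ centr s)

lemma bundleMap_injective : Function.Injective (bundleMap hm hV hH) := by
  rintro ⟨a⟩ ⟨a'⟩ h
  exact Quotient.sound ((bundlePreMap_eq_iff hm hV hH a a').1 h)

lemma continuous_bundlePreMap : Continuous (bundlePreMap hm hV) := by
  rw [Topology.IsInducing.subtypeVal.continuous_iff]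
  change Continuous fun a : centr s × V =>
    (Ad (a.1 : GLn n) (a.2 : Mat n), FlagVariety.orbit ((a.1 : GLn n) * m))
  have h1 : Continuous fun a : centr s × V => (a.1 : GLn n) :=
    continuous_subtype_val.comp continuous_fst
  have h2 : Continuous fun a : centr s × V => (a.2 : Mat n) :=
    continuous_subtype_val.comp continuous_snd
  have h3 : Continuous fun a : centr s × V => FlagVariety.orbit ((a.1 : GLn n) * m) :=
    FlagVariety.continuous_orbit.comp (h1.mul continuous_const)
  exact (continuous_Ad_comp h1 h2).prodMk h3

lemma range_bundleMap : Set.range (bundleMap hm hV hH) = Set.range (bundlePreMap hm hV) :=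
  Set.range_quot_lift _

lemma mem_range_bundleMap_iff {y : NTilde s q₀} :
    y ∈ Set.range (bundleMap hm hV hH) ↔
      ∃ h ∈ centr s, conjSubgroup h (conjSubgroup m (stdBorel n)) = y.1.2.1 := by
  rw [range_bundleMap]
  constructor
  · rintro ⟨a, rfl⟩
    exact ⟨a.1, a.1.2, conjSubgroup_conjSubgroup _ _ _⟩
  · rintro ⟨h, hh, e⟩
    have hx : Ad h⁻¹ y.1.1 ∈ V := by
      rw [hV]
      refine ⟨?_, Ad_mem_nilcone (inv_mem hh) y.2.1⟩
      have := Ad_mem_nilradical (h := h⁻¹) y.2.2.2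
      rwa [← e, conjSubgroup_conjSubgroup, inv_mul_cancel,
        conjSubgroup_eq_self (one_mem _)] at this
    refine ⟨(⟨h, hh⟩, ⟨_, hx⟩), Subtype.ext (Prod.ext (Ad_Ad_inv h _) (Subtype.ext ?_))⟩
    rw [← e, conjSubgroup_conjSubgroup]
    rfl

lemma isPreconnected_range_bundleMap : IsPreconnected (Set.range (bundleMap hm hV hH)) := by
  have h1 : PreconnectedSpace (centr s) := ⟨isPreconnected_univ_centr s⟩
  have h2 : PreconnectedSpace V := Subtype.preconnectedSpace (by
    rw [hV]
    exact isPreconnected_nilradical_inter_nilcone ⟨m, rfl⟩ s q₀)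
  rw [range_bundleMap]
  exact isPreconnected_range (continuous_bundlePreMap hm hV)


end Bundle

/-! ### The maps are isomorphisms onto open subvarieties -/

section Iso

variable {g s : GLn n} {q₀ : ℂˣ} {w : Equiv.Perm (Fin n)} {H : Subgroup (GLn n)} {V : Set (Mat n)}

/-- The section `secMat` lifts each point of the stratum to the associated bundle. -/
lemma exists_bundlePreMap_eq_proj (hs : s ∈ conjSubgroup g (stdTorus n))
    (hm : s ∈ conjSubgroup (g * permGL w) (stdBorel n))
    (hV : V = nilradical (conjSubgroup (g * permGL w) (stdBorel n)) ∩ nilcone s q₀)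
    {z : NTildeCover s q₀} (hz : z ∈ stratum g s q₀ w) :
    ∃ a : centr s × V, ((a.1 : GLn n) : Mat n) = secMat g s w (z.1.1 : Mat n) ∧
      (a.2 : Mat n) = Ad (a.1 : GLn n)⁻¹ z.1.2 ∧
      bundlePreMap hm hV a = NTildeCover.proj s q₀ z := by
  obtain ⟨h, hh, e, b, hb, e'⟩ := exists_centr_eq_secMat hs z.mem_conj hz
  have horb : FlagVariety.orbit (h * (g * permGL w)) = FlagVariety.orbit z.1.1 := by
    rw [e', eq_comm, FlagVariety.orbit_eq_iff, inv_mul_cancel_left]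
    exact hb
  have hx : Ad h⁻¹ z.1.2 ∈ V := by
    rw [hV]
    refine ⟨?_, Ad_mem_nilcone (inv_mem hh) z.2.1⟩
    have h1 := Ad_mem_nilradical (h := h⁻¹) z.2.2.2
    change _ ∈ nilradical (conjSubgroup h⁻¹ (FlagVariety.orbit z.1.1).1) at h1
    rw [← horb] at h1
    change _ ∈ nilradical (conjSubgroup h⁻¹ (conjSubgroup _ _)) at h1
    rwa [conjSubgroup_conjSubgroup, inv_mul_cancel_left] at h1
  exact ⟨(⟨h, hh⟩, ⟨_, hx⟩), e, rfl, Subtype.ext (Prod.ext (Ad_Ad_inv h _) horb)⟩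

variable (hs : s ∈ conjSubgroup g (stdTorus n))
  (hm : s ∈ conjSubgroup (g * permGL w) (stdBorel n))
  (hV : V = nilradical (conjSubgroup (g * permGL w) (stdBorel n)) ∩ nilcone s q₀)
  (hH : H = conjSubgroup (g * permGL w) (stdBorel n) ⊓ centr s)

include hs in
lemma preimage_range_bundleMap :
    NTildeCover.proj s q₀ ⁻¹' Set.range (bundleMap hm hV hH) = stratum g s q₀ w := by
  ext z
  rw [Set.mem_preimage, mem_range_bundleMap_iff]
  exact exists_centr_conj_eq_iff hs z.mem_conj

include hs in
lemma isOpenMap_bundleMap : IsOpenMap (bundleMap hm hV hH) := by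
  intro U hU
  choose σ hσ1 hσ2 hσ3 using fun z : stratum g s q₀ w => exists_bundlePreMap_eq_proj hs hm hV z.2
  have hz : Continuous fun z : stratum g s q₀ w => z.1.1 :=
    continuous_subtype_val.comp continuous_subtype_val
  have h1 : Continuous fun z => ((σ z).1 : GLn n) := by
    apply continuous_of_continuous_val
    simp only [hσ1]
    have ha : Continuous fun z : stratum g s q₀ w => ((z.1.1.1 : GLn n) : Mat n) :=
      Units.continuous_val.comp (continuous_fst.comp hz)
    refine (continuous_const.mul ?_).mul continuous_const
    refine continuous_matrix fun i j => ?_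
    by_cases hd : eigs g s i = eigs g s j
    · simp only [mask, of_apply, if_pos hd]
      exact ((continuous_const.mul ha).mul continuous_const).matrix_elem i j
    · simp only [mask, of_apply, if_neg hd]
      exact continuous_const
  have h2 : Continuous fun z => ((σ z).2 : Mat n) := by
    simp only [hσ2]
    have hx : Continuous fun z : stratum g s q₀ w => z.1.1.2 := continuous_snd.comp hz
    exact continuous_Ad_comp h1.inv hx
  have hσ : Continuous σ := (h1.subtype_mk fun z => (σ z).1.2).prodMk
    (h2.subtype_mk fun z => (σ z).2.2)
  rw [← (NTildeCover.isQuotientMap_proj s q₀).isOpen_preimage]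
  -- over the stratum, the image of `U` is the preimage of `U` under the continuous section `σ`
  have : NTildeCover.proj s q₀ ⁻¹' (bundleMap hm hV hH '' U) =
      Subtype.val '' ((fun z => (Quotient.mk (assocSetoid (centr s) H V) (σ z))) ⁻¹' U) := by
    ext z
    constructor
    · rintro ⟨y, hy, e⟩
      have hzs : z ∈ stratum g s q₀ w := by
        rw [← preimage_range_bundleMap hs hm hV hH]
        exact ⟨y, e⟩
      refine ⟨⟨z, hzs⟩, ?_, rfl⟩
      have : Quotient.mk _ (σ ⟨z, hzs⟩) = y :=
        bundleMap_injective hm hV hH ((hσ3 ⟨z, hzs⟩).trans e.symm)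
      rwa [Set.mem_preimage, this]
    · rintro ⟨z, hzU, rfl⟩
      exact ⟨_, hzU, hσ3 z⟩
  rw [this]
  exact (isOpen_stratum hs w).isOpenMap_subtype_val _
    (hU.preimage (continuous_quotient_mk'.comp hσ))

include hs in
lemma isEmbedding_bundleMap : Topology.IsEmbedding (bundleMap hm hV hH) :=
  (Topology.IsOpenEmbedding.of_continuous_injective_isOpenMap
    ((continuous_bundlePreMap hm hV).quotient_lift _)
    (bundleMap_injective hm hV hH) (isOpenMap_bundleMap hs hm hV hH)).isEmbedding

lemma val_Ad_inv (h : GLn n) (x : Mat n) :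
    Ad h⁻¹ x = (h : Mat n)⁻¹ * x * (h : Mat n) := by
  rw [Ad, inv_inv, coe_units_inv]

/-- Regular functions pull back along the bundle map, because its formula is rational. -/
lemma regularAt_comp_bundleMap {f : NTilde s q₀ → ℂ} {y : AssocBundle (centr s) H V}
    (hf : NTilde.RegularAt f (bundleMap hm hV hH y)) :
    AssocBundle.RegularAt (f ∘ bundleMap hm hV hH) y := by
  intro a ha
  let T : centr s × V → NTildeCover s q₀ := fun a =>
    ⟨((a.1 : GLn n) * (g * permGL w), Ad a.1 a.2), Ad_mk_mem_NTilde hm hV a⟩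
  have hT : ∀ a, NTildeCover.proj s q₀ (T a) = bundleMap hm hV hH (Quotient.mk _ a) := fun a => rfl
  have hF' := hf (T a) (by rw [hT, ha])
  let c : centr s × V → (Fin n × Fin n) ⊕ (Fin n × Fin n) → ℂ :=
    fun a => pairCoord ((a.1 : GLn n) : Mat n) (a.2 : Mat n)
  have hA : LocRatMat c a fun a => ((a.1 : GLn n) : Mat n) :=
    fun i j => coord_mem_locRat c a (Sum.inl (i, j))
  have hX : LocRatMat c a fun a => (a.2 : Mat n) :=
    fun i j => coord_mem_locRat c a (Sum.inr (i, j))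
  have h1 : LocRatMat c a fun a => ((T a).1.1 : Mat n) :=
    hA.mul (LocRatMat.const ((g * permGL w : GLn n) : Mat n))
  have h2 : LocRatMat c a fun a => (T a).1.2 := by
    have := (hA.mul hX).mul (hA.inv (det_val_ne_zero _))
    simpa only [T, Ad, coe_units_inv] using this
  have hG : ∀ k, (fun a => NTildeCover.coord s q₀ (T a) k) ∈ locRat c a := by
    rintro (⟨i, j⟩ | ⟨i, j⟩)
    · exact h1 i j
    · exact h2 i j
  have hcomp : ∀ a, (f ∘ bundleMap hm hV hH) (Quotient.mk _ a) =
      (f ∘ NTildeCover.proj s q₀) (T a) := fun a => rfl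
  have hmem : ((f ∘ bundleMap hm hV hH) ∘ Quotient.mk _) ∈ locRat c a :=
    mem_locRat_of_comp (F' := f ∘ NTildeCover.proj s q₀) (c' := NTildeCover.coord s q₀)
      (z₀' := T a) (r := 1) hF' hG (fun _ => rfl) (by simp)
      fun z _ => ⟨T z, fun _ => rfl, hcomp z⟩
  exact hmem

include hs in
/-- Regular functions descend along the bundle map, because it has the rational section `secMat`
over the stratum, which is a principal Zariski open set. -/
lemma regularAt_of_comp_bundleMap {f : NTilde s q₀ → ℂ} {y : AssocBundle (centr s) H V}
    (hf : AssocBundle.RegularAt (f ∘ bundleMap hm hV hH) y) :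
    NTilde.RegularAt f (bundleMap hm hV hH y) := by
  intro z hz
  let c' : centr s × V → (Fin n × Fin n) ⊕ (Fin n × Fin n) → ℂ :=
    fun a => pairCoord ((a.1 : GLn n) : Mat n) (a.2 : Mat n)
  let c := NTildeCover.coord s q₀
  have hzs : z ∈ stratum g s q₀ w := by
    rw [← preimage_range_bundleMap hs hm hV hH]
    exact ⟨y, hz.symm⟩
  let S : NTildeCover s q₀ → Mat n := fun z => secMat g s w (z.1.1 : Mat n)
  have key : ∀ z ∈ stratum g s q₀ w, ∃ a : centr s × V, ((a.1 : GLn n) : Mat n) = S z ∧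
      (a.2 : Mat n) = (S z)⁻¹ * z.1.2 * S z ∧ bundlePreMap hm hV a = NTildeCover.proj s q₀ z := by
    intro z hz
    obtain ⟨a, h1, h2, h3⟩ := exists_bundlePreMap_eq_proj hs hm hV hz
    exact ⟨a, h1, by rw [h2, val_Ad_inv, h1], h3⟩
  obtain ⟨a, h1, h2, h3⟩ := key z hzs
  have hF' := hf a (bundleMap_injective hm hV hH (h3.trans hz))
  have hA : LocRatMat c z fun z => (z.1.1 : Mat n) :=
    fun i j => coord_mem_locRat c z (Sum.inl (i, j))
  have hX : LocRatMat c z fun z => z.1.2 :=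
    fun i j => coord_mem_locRat c z (Sum.inr (i, j))
  have hS : LocRatMat c z S := hA.secMat g s w
  have hY : LocRatMat c z fun z => (S z)⁻¹ * z.1.2 * S z :=
    ((hS.inv (by rw [← h1]; exact det_val_ne_zero _)).mul hX).mul hS
  obtain ⟨r, hr⟩ := exists_poly_stratum q₀ hs w
  refine mem_locRat_of_comp (F' := (f ∘ bundleMap hm hV hH) ∘ Quotient.mk _) (c' := c')
    (z₀' := a) (G := fun k z => pairCoord (S z) ((S z)⁻¹ * z.1.2 * S z) k) (r := r) hF' ?_ ?_
    ((hr z).2 hzs) fun z hz => ?_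
  · rintro (⟨i, j⟩ | ⟨i, j⟩)
    · exact hS i j
    · exact hY i j
  · intro k
    simp only [c', h1, h2]
  · obtain ⟨a, h1, h2, h3⟩ := key z ((hr z).1 hz)
    exact ⟨a, fun k => by simp only [c', h1, h2], congrArg f h3.symm⟩

end Iso

end SpringerFixed

end

theorem mainTheorem3 (n : ℕ) (s : SpringerFixed.GLn n) (q₀ : ℂˣ)
    (B T : Subgroup (SpringerFixed.GLn n))
    (hB : SpringerFixed.IsBorel B) (hT : SpringerFixed.IsMaximalTorus T) (hTB : T ≤ B)
    (hs : s ∈ T) :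
    -- the identification of the Weyl group of `(T, B)` with `S_n` exists; fix any such
    (∃ g, SpringerFixed.IsAdapted g T B) ∧
    ∀ g, SpringerFixed.IsAdapted g T B →
      -- the Borel subgroups `B'` with `B'(s) = B(s)` are the `^wB`, without repetition
      ({B' | SpringerFixed.IsBorel B' ∧ s ∈ B' ∧
          B' ⊓ SpringerFixed.centr s = B ⊓ SpringerFixed.centr s} =
        (fun w => SpringerFixed.twistBorel g w B) '' SpringerFixed.minReps g s) ∧
      ({B' | SpringerFixed.IsBorel B' ∧ T ≤ B' ∧
          B' ⊓ SpringerFixed.centr s = B ⊓ SpringerFixed.centr s} =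
        (fun w => SpringerFixed.twistBorel g w B) '' SpringerFixed.minReps g s) ∧
      Set.InjOn (fun w => SpringerFixed.twistBorel g w B) (SpringerFixed.minReps g s) ∧
      -- `B(s)` acts on `^w𝔫 ∩ 𝒩^{(s,q₀)}`
      (∀ w ∈ SpringerFixed.minReps g s, ∀ b ∈ B ⊓ SpringerFixed.centr s,
        ∀ x ∈ SpringerFixed.fibre g w B s q₀,
          SpringerFixed.Ad b x ∈ SpringerFixed.fibre g w B s q₀) ∧
      -- the maps `[h, x] ↦ (h x h⁻¹, h ^wB h⁻¹)`
      ∃ φ : ∀ w : SpringerFixed.minReps g s,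
          SpringerFixed.AssocBundle (SpringerFixed.centr s) (B ⊓ SpringerFixed.centr s)
            (SpringerFixed.fibre g w B s q₀) → SpringerFixed.NTilde s q₀,
        (∀ (w : SpringerFixed.minReps g s) (h : SpringerFixed.centr s)
            (x : SpringerFixed.fibre g w B s q₀),
          (φ w (Quotient.mk _ (h, x))).1.1 = SpringerFixed.Ad h x ∧
          (φ w (Quotient.mk _ (h, x))).1.2.1 =
            SpringerFixed.conjSubgroup h (SpringerFixed.twistBorel g w B)) ∧
        -- are isomorphisms of varieties, and homeomorphisms, onto their images,
        (∀ w, Topology.IsEmbedding (φ w) ∧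
          ∀ f y, SpringerFixed.NTilde.RegularAt f (φ w y) ↔
            SpringerFixed.AssocBundle.RegularAt (f ∘ φ w) y) ∧
        -- and these images are exactly the connected components, each for exactly one `w`,
        -- in the analytic and in the Zariski topology
        Set.BijOn (fun w => Set.range (φ w)) Set.univ
          (Set.range fun y : SpringerFixed.NTilde s q₀ => connectedComponent y) ∧
        Set.BijOn (fun w => Set.range (φ w)) Set.univ
          (Set.range fun y : SpringerFixed.NTilde s q₀ =>
            @connectedComponent _ (SpringerFixed.NTilde.zariski s q₀) y) := by
  open SpringerFixed in
  refine ⟨exists_isAdapted hB hT hTB, fun g hA => ?_⟩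
  have hs' : s ∈ conjSubgroup g (stdTorus n) := hA.1 ▸ hs
  have hm : ∀ w : Equiv.Perm (Fin n), s ∈ conjSubgroup (g * permGL w) (stdBorel n) :=
    fun w => stdTorus_le_conj_permGL w hs'
  have hV : ∀ w : Equiv.Perm (Fin n), fibre g w B s q₀ =
      nilradical (conjSubgroup (g * permGL w) (stdBorel n)) ∩ nilcone s q₀ := fun w => by
    rw [fibre_eq, twistBorel_eq hA]
  have hH : ∀ w : minReps g s, B ⊓ centr s =
      conjSubgroup (g * permGL (w : Equiv.Perm (Fin n))) (stdBorel n) ⊓ centr s := fun w => by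
    rw [(twist_inf_centr_eq_iff hs').2 w.2, ← hA.2]
  have hopen : ∀ w : minReps g s, @IsOpen _ (NTilde.zariski s q₀)
      (Set.range (bundleMap (hm w) (hV w) (hH w))) := fun w =>
    isOpen_zariski_of_preimage_eq_stratum hs' (preimage_range_bundleMap hs' _ _ _)
  have hne : ∀ w : minReps g s, (Set.range (bundleMap (hm w) (hV w) (hH w))).Nonempty := by
    intro w
    have h0 : (0 : Mat n) ∈ fibre g w B s q₀ := by
      rw [hV]
      exact ⟨zero_mem_nilradical ⟨_, rfl⟩, zero_mem_nilcone s q₀⟩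
    exact ⟨_, ⟨Quotient.mk _ (1, ⟨0, h0⟩), rfl⟩⟩
  have hmem : ∀ (w : minReps g s) (z : NTildeCover s q₀),
      NTildeCover.proj s q₀ z ∈ Set.range (bundleMap (hm w) (hV w) (hH w)) ↔
        z ∈ stratum g s q₀ w := fun w z => by
    rw [← preimage_range_bundleMap hs' (hm w) (hV w) (hH w)]
    rfl
  have hdisj : ∀ (w w' : minReps g s) (y : NTilde s q₀),
      y ∈ Set.range (bundleMap (hm w) (hV w) (hH w)) →
      y ∈ Set.range (bundleMap (hm w') (hV w') (hH w')) → w = w' := by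
    intro w w' y h h'
    obtain ⟨z, rfl⟩ := NTildeCover.proj_surjective s q₀ y
    rw [hmem] at h h'
    exact Subtype.ext ((mem_minReps_iff.1 w.2).eq_of_comp_eq (mem_minReps_iff.1 w'.2)
      fun i => (h i).symm.trans (h' i))
  have hcov : ∀ y : NTilde s q₀, ∃ w : minReps g s,
      y ∈ Set.range (bundleMap (hm w) (hV w) (hH w)) := by
    intro y
    obtain ⟨z, rfl⟩ := NTildeCover.proj_surjective s q₀ y
    obtain ⟨w, hw, h⟩ := exists_minReps_eigs_eq hs' z.mem_conj
    exact ⟨⟨w, hw⟩, (hmem ⟨w, hw⟩ z).2 h⟩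
  have hpre : ∀ w : minReps g s,
      IsPreconnected (Set.range (bundleMap (hm w) (hV w) (hH w))) := fun w =>
    isPreconnected_range_bundleMap _ _ _
  have hle := analytic_le_zariski s q₀
  refine ⟨(setOf_mem_borel_eq hA hs).trans (setOf_torus_le_eq hA hs), setOf_torus_le_eq hA hs,
    injOn_twistBorel hA, ?_, fun w => bundleMap (hm w) (hV w) (hH w), ?_, ?_, ?_, ?_⟩
  · intro w hw b hb x hx
    rw [hV] at hx ⊢
    rw [hH ⟨w, hw⟩] at hb
    obtain ⟨hb1, hb2⟩ := Subgroup.mem_inf.1 hb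
    refine ⟨?_, Ad_mem_nilcone hb2 hx.2⟩
    have := Ad_mem_nilradical (h := b) hx.1
    rwa [conjSubgroup_eq_self hb1] at this
  · intro w h x
    refine ⟨rfl, ?_⟩
    rw [twistBorel_eq hA, conjSubgroup_conjSubgroup]
    rfl
  · exact fun w => ⟨isEmbedding_bundleMap hs' _ _ _, fun f y =>
      ⟨regularAt_comp_bundleMap _ _ _, regularAt_of_comp_bundleMap hs' _ _ _⟩⟩
  · exact bijOn_range_connectedComponent hne hpre (fun w => hle _ (hopen w)) hdisj hcov
  · refine @bijOn_range_connectedComponent _ _ (NTilde.zariski s q₀) _ hne (fun w => ?_) hopen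
      hdisj hcov
    -- a preconnected set stays preconnected in a coarser topology
    intro u v hu hv
    exact hpre w u v (hle _ hu) (hle _ hv)
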